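/- All logarithms are to base $2$. A function $g:\{0,1\}^n\to\{0,1\}$ is a $k$-junta if it depends on at most $k$ of its $n$ input variables. A function $f:\{0,1\}^n\to\{0,1\}$ is $\varepsilon$-close to $k$-juntas if it disagrees with some $k$-junta on at most $\varepsilon 2^n$ points, and $\varepsilon$-far from $k$-juntas if it disagrees with every $k$-junta on at least $\varepsilon 2^n$ points. A $(k,\varepsilon_1,\varepsilon_2)$-tolerant junta tester is a randomized algorithm that, for every $n$, has adaptive query access to an unknown $f:\{0,1\}^n\to\{0,1\}$, accepts with probability at least $2/3$ if $f$ is $\varepsilon_1$-close to $k$-juntas, and rejects with probability at least $2/3$ if $f$ is $\varepsilon_2$-far from $k$-juntas. Its number of queries is counted in the worst case over $n$, $f$ and its randomness. **Theorem 2.1.** For all constants $C,A>0$ there is a constant $c>0$ such that the following holds. Let $k$ be a nonnegative integer and let $0<\varepsilon_1<\varepsilon_2\le 0.49$ satisfy $$\varepsilon_2-\varepsilon_1\ \ge\ 2^{-C k^{0.99}}\qquad\text{and}\qquad \Bigl(1-\frac{\varepsilon_1}{\varepsilon_2}\Bigr)^{-1}\ \ge\ \bigl(\log(1/\varepsilon_2)\bigr)^{A}.$$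 Then every $(k,\varepsilon_1,\varepsilon_2)$-tolerant junta tester makes at least $$k^{-c\,\log(1-\varepsilon_1/\varepsilon_2)}$$ queries. -/

import Mathlib

/-- A Boolean function on the cube `{0,1}^n`. -/
abbrev BoolFun (n : ℕ) : Type := (Fin n → Bool) → Bool

/-- `f` is a `k`-junta: it depends only on (at most) `k` of its input variables. -/
def IsJunta {n : ℕ} (k : ℕ) (f : BoolFun n) : Prop :=
  ∃ S : Finset (Fin n), S.card ≤ k ∧ DependsOn f (S : Set (Fin n))

/-- `f` is `ε`-close to `k`-juntas: it disagrees with some `k`-junta on at most `ε 2^n` entries. -/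
def IsCloseToJuntas {n : ℕ} (k : ℕ) (ε : ℝ) (f : BoolFun n) : Prop :=
  ∃ g : BoolFun n, IsJunta k g ∧ (hammingDist f g : ℝ) ≤ ε * 2 ^ n

/-- `f` is `ε`-far from `k`-juntas: it disagrees with every `k`-junta on at least `ε 2^n` entries. -/
def IsFarFromJuntas {n : ℕ} (k : ℕ) (ε : ℝ) (f : BoolFun n) : Prop :=
  ∀ g : BoolFun n, IsJunta k g → ε * 2 ^ n ≤ (hammingDist f g : ℝ)

/-- A deterministic adaptive query algorithm on functions of `n` variables: it either stops
(`leaf true` accepts, `leaf false` rejects) or queries the value at a point `x` and continues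
with one of two algorithms according to the answer. -/
inductive QueryTree (n : ℕ) : Type
  | leaf (answer : Bool) : QueryTree n
  | query (x : Fin n → Bool) (ifFalse ifTrue : QueryTree n) : QueryTree n

namespace QueryTree

/-- The answer on input `f` (`true` means accept). -/
def run {n : ℕ} (f : BoolFun n) : QueryTree n → Bool
  | leaf b => b
  | query x t₀ t₁ => if f x = true then run f t₁ else run f t₀

/-- The number of queries made on input `f`. -/
def numQueries {n : ℕ} (f : BoolFun n) : QueryTree n → ℕ
  | leaf _ => 0
  | query x t₀ t₁ => (if f x = true then numQueries f t₁ else numQueries f t₀) + 1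

end QueryTree

/-- A randomized adaptive query algorithm for Boolean functions on any number `n` of variables:
for every `n`, a probability distribution over deterministic adaptive query algorithms. -/
abbrev RandomizedAlgorithm : Type := (n : ℕ) → PMF (QueryTree n)

/-- The probability that `T` answers `b` on input `f`. -/
noncomputable def RandomizedAlgorithm.prob (T : RandomizedAlgorithm) {n : ℕ} (f : BoolFun n)
    (b : Bool) : ENNReal :=
  ((T n).map (QueryTree.run f)) b

/-- `T` is a `(k, ε₁, ε₂)`-tolerant junta tester: with probability at least `2/3` it accepts every
function that is `ε₁`-close to `k`-juntas, and with probability at least `2/3` it rejects every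
function that is `ε₂`-far from `k`-juntas. -/
def IsTolerantJuntaTester (k : ℕ) (ε₁ ε₂ : ℝ) (T : RandomizedAlgorithm) : Prop :=
  ∀ (n : ℕ) (f : BoolFun n),
    (IsCloseToJuntas k ε₁ f → 2 / 3 ≤ T.prob f true) ∧
    (IsFarFromJuntas k ε₂ f → 2 / 3 ≤ T.prob f false)

/-- `T` makes at least `q` queries in the worst case: on some input function, some outcome of its
randomness (of positive probability) makes it query at least `q` times. -/
def RandomizedAlgorithm.MakesAtLeast (T : RandomizedAlgorithm) (q : ℝ) : Prop :=
  ∃ (n : ℕ) (f : BoolFun n), ∃ t ∈ (T n).support, q ≤ (t.numQueries f : ℝ)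

/-!
Write `η = 1 - ε₁ / ε₂` and let `b` be about an eighth of `log₂ (1 / η)`, but at least `1`. Take
`n = k + 16 b` variables and hide sixteen disjoint blocks of `b` coordinates among them, each in a
known part of the coordinates. Two random functions are compared. Both vanish off a known set `Z`
of density slightly above `2 ε₂`, which depends only on coordinates outside the parts. On `Z`, the
first is uniformly random; the second is uniformly random subject to being invariant under
complementing any of the hidden blocks.

* *They look alike.* All answers are fair coins unless two distinct queried points differ by a
  union of hidden blocks. For two given points this has probability at most `1 / choose M b`, where
  `M` is the size of a part, of order `k`; as `b` is at most of order `k ^ 0.99`, the binomial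
  coefficient is at least `k ^ (0.005 b)`, so `k ^ (c log₂ (1 / η))` queries do not suffice, even
  adaptively (`card_run_le`, `card_blockRep_eq_le`, `not_isTolerantJuntaTester`).

* *The first is far from `k`-juntas.* A `k`-junta is constant on cells of at least `2 ^ (16 b)`
  points. Only cells with more than half of their points in `Z` matter, so Hoeffding's inequality
  and a union bound over the juntas show that none agrees with the function on more than a fraction
  `1/2 + 2 ^ (-8 b)` of `Z` (`card_not_isFarFromJuntas_le`).

* *The second is close to `k`-juntas.* On a cell of the partition by the `k` coordinates outside the
  blocks it takes only `2 ^ (16 b - 16)` independent values, so by Khinchine's and Chebyshev's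
  inequalities the majority value of each cell has an advantage of at least
  `(5/36) * 2 ^ (8 - 8 b)`, much larger than `2 ^ (-8 b)` and than `η`
  (`card_not_isCloseToJuntas_le`). For `b = 1` the blocks are singletons and the function is itself
  a `k`-junta.

For `k` below a constant depending on `C`, the constant `c` is taken so small that at most two
queries are claimed, and a single query cannot tell a random constant from a random function.
-/

/-! ### Query trees -/

namespace QueryTree

variable {n : ℕ}

/-- The points that a query tree looks at on input `f`. -/
def queried (f : BoolFun n) : QueryTree n → Finset (Fin n → Bool)
  | leaf _ => ∅
  | query x t₀ t₁ => insert x (if f x = true then queried f t₁ else queried f t₀)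

lemma card_queried_le (f : BoolFun n) (t : QueryTree n) :
    (t.queried f).card ≤ t.numQueries f := by
  induction t with
  | leaf b => simp [queried]
  | query x t₀ t₁ h₀ h₁ =>
    simp only [queried, numQueries]
    refine (Finset.card_insert_le _ _).trans ?_
    split_ifs <;> omega

lemma run_queried_congr {f g : BoolFun n} {t : QueryTree n} (h : ∀ x ∈ t.queried f, g x = f x) :
    t.run g = t.run f ∧ t.queried g = t.queried f := by
  induction t with
  | leaf b => simp [queried, run]
  | query x t₀ t₁ h₀ h₁ =>
    have hx : g x = f x := h x (by simp [queried])
    simp only [queried, run, hx] at h ⊢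
    split_ifs at h ⊢ with hf
    · obtain ⟨ha, hb⟩ := h₁ fun y hy => h y (Finset.mem_insert_of_mem hy)
      exact ⟨ha, by rw [hb]⟩
    · obtain ⟨ha, hb⟩ := h₀ fun y hy => h y (Finset.mem_insert_of_mem hy)
      exact ⟨ha, by rw [hb]⟩

end QueryTree

/-- The function equal to `h` on `Z` and to `false` elsewhere. -/
def maskTo {X : Type*} [DecidableEq X] (Z : Finset X) (h : X → Bool) : X → Bool :=
  fun x => decide (x ∈ Z) && h x

/-- A map that is injective on `Q` can be undone on `Q` by a permutation. -/
lemma exists_perm_undo {X : Type*} [Fintype X] [DecidableEq X] (π : X → X) (Q : Finset X)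
    (hQ : Set.InjOn π Q) : ∃ ρ : Equiv.Perm X, ∀ x ∈ Q, ρ (π x) = x := by
  classical
  let e : {x // x ∈ Q} ≃ {x // x ∈ Q.image π} :=
    (Equiv.Set.imageOfInjOn π (Q : Set X) hQ).trans (Equiv.subtypeEquivRight (by simp))
  refine ⟨e.extendSubtype.symm, fun x hx => ?_⟩
  rw [Equiv.symm_apply_eq, e.extendSubtype_apply_of_mem x hx]
  rfl

/-- Merging the points of the cube along `π` can only lose those outcomes of a uniformly random
`h` in which two queried points are merged: rearranging `h` so that `h ∘ π` takes the same values
at the queried points is injective, as the queried points can be read off from the result. -/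
lemma card_run_le {n : ℕ} (π : (Fin n → Bool) → (Fin n → Bool)) (Z : Finset (Fin n → Bool))
    (t : QueryTree n) (b : Bool) :
    (Finset.univ.filter fun h : BoolFun n => t.run (maskTo Z h) = b ∧
        Set.InjOn π (t.queried (maskTo Z h) : Set (Fin n → Bool))).card ≤
      (Finset.univ.filter fun h : BoolFun n => t.run (maskTo Z (h ∘ π)) = b).card := by
  classical
  choose! ρ hρ using fun Q (hQ : Set.InjOn π (Q : Finset (Fin n → Bool))) =>
    exists_perm_undo π Q hQ
  let φ : BoolFun n → BoolFun n := fun h => h ∘ ρ (t.queried (maskTo Z h))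
  have key : ∀ h, Set.InjOn π (t.queried (maskTo Z h) : Set (Fin n → Bool)) →
      t.run (maskTo Z (φ h ∘ π)) = t.run (maskTo Z h) ∧
        t.queried (maskTo Z (φ h ∘ π)) = t.queried (maskTo Z h) := by
    intro h hh
    apply QueryTree.run_queried_congr
    intro x hx
    simp only [maskTo, φ, Function.comp, hρ _ hh x hx]
  refine Finset.card_le_card_of_injOn φ ?_ ?_
  · intro h hh
    simp only [Finset.coe_filter, Finset.mem_univ, true_and, Set.mem_ofPred_eq] at hh ⊢
    rw [(key h hh.2).1, hh.1]
  · intro h hh h' hh' heq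
    simp only [Finset.coe_filter, Finset.mem_univ, true_and, Set.mem_ofPred_eq] at hh hh'
    have hq : t.queried (maskTo Z h) = t.queried (maskTo Z h') := by
      rw [← (key h hh.2).2, ← (key h' hh'.2).2, heq]
    have : h ∘ ρ (t.queried (maskTo Z h)) = h' ∘ ρ (t.queried (maskTo Z h)) := by
      rw [show h' ∘ ρ (t.queried (maskTo Z h)) = φ h' by simp only [φ, hq]]
      exact heq
    exact (ρ _).surjective.injective_comp_right this

/-! ### Indistinguishable random functions defeat a tester -/

open Classical in
lemma card_not_injOn_le {X ι : Type*} [DecidableEq X] (I : Finset ι) (π : ι → X → X)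
    {α : ℝ} (hα : ∀ x y, x ≠ y → ((I.filter fun σ => π σ x = π σ y).card : ℝ) ≤ α * I.card)
    (hα0 : 0 ≤ α) (Q : Finset X) {q : ℕ} (hQ : Q.card ≤ q) :
    ((I.filter fun σ => ¬ Set.InjOn (π σ) (Q : Set X)).card : ℝ) ≤
      q * (q - 1) * α * I.card := by
  classical
  have hsub : (I.filter fun σ => ¬ Set.InjOn (π σ) (Q : Set X)) ⊆
      Q.offDiag.biUnion fun p => I.filter fun σ => π σ p.1 = π σ p.2 := by
    intro σ hσ
    simp only [Finset.mem_filter, Set.InjOn, not_forall] at hσ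
    obtain ⟨hσ, x, hx, y, hy, hxy, hne⟩ := hσ
    simp only [Finset.mem_biUnion, Finset.mem_filter, Finset.mem_offDiag]
    exact ⟨(x, y), ⟨hx, hy, hne⟩, hσ, hxy⟩
  have h1 : ((I.filter fun σ => ¬ Set.InjOn (π σ) (Q : Set X)).card : ℝ) ≤
      ∑ p ∈ Q.offDiag, ((I.filter fun σ => π σ p.1 = π σ p.2).card : ℝ) := by
    exact_mod_cast (Finset.card_le_card hsub).trans Finset.card_biUnion_le
  have h2 : ∑ p ∈ Q.offDiag, ((I.filter fun σ => π σ p.1 = π σ p.2).card : ℝ) ≤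
      Q.offDiag.card * (α * I.card) := by
    rw [← nsmul_eq_mul]
    exact Finset.sum_le_card_nsmul _ _ _ fun p hp => hα _ _ (Finset.mem_offDiag.1 hp).2.2
  have h3 : (Q.offDiag.card : ℝ) ≤ q * (q - 1) := by
    rw [Finset.offDiag_card, Nat.cast_sub (Nat.le_mul_self _)]
    push_cast
    rcases Nat.eq_zero_or_pos Q.card with h0 | h0
    · rw [h0]
      rcases Nat.eq_zero_or_pos q with rfl | hq
      · simp
      · have : (1 : ℝ) ≤ q := by exact_mod_cast hq
        norm_num
        nlinarith
    · have ha : (1 : ℝ) ≤ Q.card := by exact_mod_cast h0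
      have hb : (Q.card : ℝ) ≤ q := by exact_mod_cast hQ
      nlinarith
  calc _ ≤ Q.offDiag.card * (α * I.card) := h1.trans h2
    _ ≤ (q * (q - 1)) * (α * I.card) := by gcongr
    _ = _ := by ring

/-- A tree with few queries answers `b` on the merged random function almost as often as on the
unmerged one, when any two points are rarely merged. -/
lemma card_run_merged_ge {n : ℕ} {ι : Type*} (I : Finset ι)
    (π : ι → (Fin n → Bool) → (Fin n → Bool)) (Z : Finset (Fin n → Bool)) {α : ℝ}
    (hα : ∀ x y, x ≠ y → ((I.filter fun σ => π σ x = π σ y).card : ℝ) ≤ α * I.card)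
    (hα0 : 0 ≤ α) {q : ℕ} (hq : q * (q - 1) * α ≤ (1 / 10 : ℝ)) (t : QueryTree n)
    (ht : ∀ f, t.numQueries f ≤ q) (b : Bool) :
    9 * (I.card * (Finset.univ.filter fun h : BoolFun n => t.run (maskTo Z h) = b).card) ≤
      10 * ∑ σ ∈ I,
        (Finset.univ.filter fun h : BoolFun n => t.run (maskTo Z (h ∘ π σ)) = b).card := by
  classical
  have h1 : ∑ σ ∈ I, (Finset.univ.filter fun h : BoolFun n => t.run (maskTo Z h) = b ∧
        Set.InjOn (π σ) (t.queried (maskTo Z h) : Set (Fin n → Bool))).card ≤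
      ∑ σ ∈ I, (Finset.univ.filter fun h : BoolFun n => t.run (maskTo Z (h ∘ π σ)) = b).card :=
    Finset.sum_le_sum fun σ _ => card_run_le (π σ) Z t b
  have h2 : ∑ σ ∈ I, (Finset.univ.filter fun h : BoolFun n => t.run (maskTo Z h) = b ∧
        Set.InjOn (π σ) (t.queried (maskTo Z h) : Set (Fin n → Bool))).card =
      ∑ h ∈ Finset.univ.filter fun h : BoolFun n => t.run (maskTo Z h) = b,
        (I.filter fun σ => Set.InjOn (π σ) (t.queried (maskTo Z h) : Set (Fin n → Bool))).card := by
    simp only [← Finset.filter_filter]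
    exact Finset.sum_card_bipartiteAbove_eq_sum_card_bipartiteBelow _
  have h3 : ∀ h : BoolFun n, (9 / 10 : ℝ) * I.card ≤ (I.filter fun σ =>
      Set.InjOn (π σ) (t.queried (maskTo Z h) : Set (Fin n → Bool))).card := by
    intro h
    have ha := card_not_injOn_le I π hα hα0 (t.queried (maskTo Z h))
      ((QueryTree.card_queried_le _ _).trans (ht _))
    have hb := Finset.card_filter_add_card_filter_not (s := I) fun σ =>
      Set.InjOn (π σ) (t.queried (maskTo Z h) : Set (Fin n → Bool))
    have hc : (q * (q - 1) * α) * I.card ≤ (1 / 10 : ℝ) * I.card := by gcongr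
    have hd : ((I.filter fun σ => Set.InjOn (π σ)
        (t.queried (maskTo Z h) : Set (Fin n → Bool))).card : ℝ) + (I.filter fun σ =>
        ¬ Set.InjOn (π σ) (t.queried (maskTo Z h) : Set (Fin n → Bool))).card = I.card := by
      exact_mod_cast hb
    linarith
  have h4 : ((Finset.univ.filter fun h : BoolFun n => t.run (maskTo Z h) = b).card : ℝ) *
      ((9 / 10 : ℝ) * I.card) ≤
      ∑ h ∈ Finset.univ.filter fun h : BoolFun n => t.run (maskTo Z h) = b, ((I.filter fun σ =>
        Set.InjOn (π σ) (t.queried (maskTo Z h) : Set (Fin n → Bool))).card : ℝ) := by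
    rw [← nsmul_eq_mul]
    exact Finset.card_nsmul_le_sum _ _ _ fun h _ => h3 h
  rw [h2] at h1
  have h5 : (9 * (I.card * (Finset.univ.filter fun h : BoolFun n =>
      t.run (maskTo Z h) = b).card) : ℝ) ≤ 10 * ∑ σ ∈ I, ((Finset.univ.filter fun h : BoolFun n =>
        t.run (maskTo Z (h ∘ π σ)) = b).card : ℝ) := by
    have h1' := (Nat.cast_le (α := ℝ)).2 h1
    push_cast at h1'
    linarith
  exact_mod_cast h5

lemma prob_eq_tsum (T : RandomizedAlgorithm) {n : ℕ} (f : BoolFun n) (b : Bool) :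
    T.prob f b = ∑' t, T n t * (if t.run f = b then 1 else 0) := by
  rw [RandomizedAlgorithm.prob, PMF.map_apply]
  refine tsum_congr fun t => ?_
  by_cases h : t.run f = b
  · simp [h]
  · simp [h, Ne.symm h]

lemma prob_true_add_prob_false (T : RandomizedAlgorithm) {n : ℕ} (f : BoolFun n) :
    T.prob f true + T.prob f false = 1 := by
  have := ((T n).map (QueryTree.run f)).tsum_coe
  rwa [tsum_fintype, Fintype.sum_bool] at this

lemma sum_prob_eq_tsum (T : RandomizedAlgorithm) {n : ℕ} {ι : Type*} (s : Finset ι)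
    (F : ι → BoolFun n) (b : Bool) :
    ∑ i ∈ s, T.prob (F i) b = ∑' t, T n t * ((s.filter fun i => t.run (F i) = b).card : ENNReal) := by
  simp only [prob_eq_tsum]
  rw [← Summable.tsum_finsetSum fun _ _ => ENNReal.summable]
  refine tsum_congr fun t => ?_
  rw [← Finset.mul_sum, Finset.sum_boole]

open Classical in
/-- Yao's principle for a pair of random functions: `h` masked to `Z` is mostly far from juntas,
the merged `h ∘ π σ` masked to `Z` is mostly close to juntas, and points are rarely merged. -/
lemma not_isTolerantJuntaTester {n k : ℕ} {ε₁ ε₂ : ℝ} {ι : Type*} (I : Finset ι)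
    (hI : I.Nonempty) (π : ι → (Fin n → Bool) → (Fin n → Bool)) (Z : Finset (Fin n → Bool)) {α : ℝ}
    (hα : ∀ x y, x ≠ y → ((I.filter fun σ => π σ x = π σ y).card : ℝ) ≤ α * I.card)
    (hα0 : 0 ≤ α) {q : ℕ} (hq : q * (q - 1) * α ≤ (1 / 10 : ℝ))
    (hclose : ∀ σ ∈ I, ((Finset.univ.filter fun h : BoolFun n =>
      ¬ IsCloseToJuntas k ε₁ (maskTo Z (h ∘ π σ))).card : ℝ) ≤
        1 / 20 * Fintype.card (BoolFun n))
    (hfar : ((Finset.univ.filter fun h : BoolFun n =>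
      ¬ IsFarFromJuntas k ε₂ (maskTo Z h)).card : ℝ) ≤ 1 / 20 * Fintype.card (BoolFun n))
    (T : RandomizedAlgorithm) (hTq : ∀ t ∈ (T n).support, ∀ f, t.numQueries f ≤ q) :
    ¬ IsTolerantJuntaTester k ε₁ ε₂ T := by
  classical
  intro hT
  set N := Fintype.card (BoolFun n) with hN
  have hNpos : (0 : ℝ) < N := by rw [hN]; exact_mod_cast Fintype.card_pos
  have hIpos : (0 : ℝ) < I.card := by exact_mod_cast hI.card_pos
  -- rejection is almost as likely on the merged functions as on the unmerged ones
  have hcmp : 9 * (I.card * ∑ h : BoolFun n, T.prob (maskTo Z h) false) ≤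
      10 * ∑ σ ∈ I, ∑ h : BoolFun n, T.prob (maskTo Z (h ∘ π σ)) false := by
    simp only [sum_prob_eq_tsum]
    rw [← Summable.tsum_finsetSum fun _ _ => ENNReal.summable, ← ENNReal.tsum_mul_left,
      ← ENNReal.tsum_mul_left, ← ENNReal.tsum_mul_left]
    refine ENNReal.tsum_le_tsum fun t => ?_
    by_cases ht : t ∈ (T n).support
    · have h := card_run_merged_ge I π Z hα hα0 hq t (hTq t ht) false
      have h' : (9 * (I.card * (Finset.univ.filter fun h : BoolFun n =>
          t.run (maskTo Z h) = false).card) : ENNReal) ≤ 10 * ∑ σ ∈ I,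
          ((Finset.univ.filter fun h : BoolFun n =>
            t.run (maskTo Z (h ∘ π σ)) = false).card : ENNReal) := by exact_mod_cast h
      calc _ = T n t * (9 * (I.card * (Finset.univ.filter fun h : BoolFun n =>
          t.run (maskTo Z h) = false).card)) := by ring
        _ ≤ T n t * _ := mul_le_mul_right h' _
        _ = _ := by rw [← Finset.mul_sum]; ring
    · have : T n t = 0 := by simpa using ht
      simp [this]
  have htop : ∀ f : BoolFun n, T.prob f false ≠ ⊤ := fun f => PMF.apply_ne_top _ _
  have htop' : ∀ f : BoolFun n, T.prob f true ≠ ⊤ := fun f => PMF.apply_ne_top _ _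
  let p : BoolFun n → ℝ := fun f => (T.prob f false).toReal
  have hp0 : ∀ f, 0 ≤ p f := fun f => ENNReal.toReal_nonneg
  have hpr : ∀ f, (T.prob f true).toReal + p f = 1 := by
    intro f
    simp only [p]
    rw [← ENNReal.toReal_add (htop' f) (htop f), prob_true_add_prob_false]
    rfl
  have hp1 : ∀ f, p f ≤ 1 := fun f => by
    have := hpr f
    have h0 : 0 ≤ (T.prob f true).toReal := ENNReal.toReal_nonneg
    linarith
  have h23 : ((2 / 3 : ENNReal)).toReal = 2 / 3 := by simp
  have hfar' : ∀ f, IsFarFromJuntas k ε₂ f → 2 / 3 ≤ p f := fun f hf => by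
    rw [← h23]
    exact ENNReal.toReal_mono (htop f) ((hT n f).2 hf)
  have hclose' : ∀ f, IsCloseToJuntas k ε₁ f → p f ≤ 1 / 3 := fun f hf => by
    have : 2 / 3 ≤ (T.prob f true).toReal := by
      rw [← h23]
      exact ENNReal.toReal_mono (htop' f) ((hT n f).1 hf)
    linarith [hpr f]
  have hcmp' : 9 * (I.card * ∑ h : BoolFun n, p (maskTo Z h)) ≤
      10 * ∑ σ ∈ I, ∑ h : BoolFun n, p (maskTo Z (h ∘ π σ)) := by
    have hfin : 10 * ∑ σ ∈ I, ∑ h : BoolFun n, T.prob (maskTo Z (h ∘ π σ)) false ≠ ⊤ :=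
      ENNReal.mul_ne_top (by simp)
        (ENNReal.sum_ne_top.2 fun σ _ => ENNReal.sum_ne_top.2 fun h _ => htop _)
    have h := ENNReal.toReal_mono hfin hcmp
    rw [ENNReal.toReal_mul, ENNReal.toReal_mul, ENNReal.toReal_mul,
      ENNReal.toReal_sum fun _ _ => htop _,
      ENNReal.toReal_sum fun σ _ => ENNReal.sum_ne_top.2 fun h _ => htop _] at h
    simp only [ENNReal.toReal_sum fun _ _ => htop _] at h
    simpa using h
  have hno : 19 / 30 * (N : ℝ) ≤ ∑ h : BoolFun n, p (maskTo Z h) := by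
    have h1 : ∀ h : BoolFun n, 2 / 3 - 2 / 3 *
        (if ¬ IsFarFromJuntas k ε₂ (maskTo Z h) then 1 else 0) ≤ p (maskTo Z h) := by
      intro h
      split_ifs with hh
      · simpa using hfar' _ hh
      · simpa using hp0 _
    have h2 := Finset.sum_le_sum fun h (_ : h ∈ (Finset.univ : Finset (BoolFun n))) => h1 h
    rw [Finset.sum_sub_distrib, ← Finset.mul_sum, Finset.sum_boole, Finset.sum_const,
      Finset.card_univ, nsmul_eq_mul] at h2
    linarith
  have hyes : ∀ σ ∈ I, ∑ h : BoolFun n, p (maskTo Z (h ∘ π σ)) ≤ 23 / 60 * (N : ℝ) := by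
    intro σ hσ
    have h1 : ∀ h : BoolFun n, p (maskTo Z (h ∘ π σ)) ≤ 1 / 3 +
        (if ¬ IsCloseToJuntas k ε₁ (maskTo Z (h ∘ π σ)) then 1 else 0) := by
      intro h
      split_ifs with hh
      · simpa using hclose' _ hh
      · linarith [hp1 (maskTo Z (h ∘ π σ))]
    have h2 := Finset.sum_le_sum fun h (_ : h ∈ (Finset.univ : Finset (BoolFun n))) => h1 h
    rw [Finset.sum_add_distrib, Finset.sum_boole, Finset.sum_const, Finset.card_univ,
      nsmul_eq_mul] at h2
    have h3 := hclose σ hσ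
    linarith
  have hyes' : ∑ σ ∈ I, ∑ h : BoolFun n, p (maskTo Z (h ∘ π σ)) ≤
      I.card * (23 / 60 * (N : ℝ)) := by
    rw [← nsmul_eq_mul]
    exact Finset.sum_le_card_nsmul _ _ _ hyes
  have hno' : I.card * (19 / 30 * (N : ℝ)) ≤ I.card * ∑ h : BoolFun n, p (maskTo Z h) := by
    gcongr
  nlinarith [mul_pos hIpos hNpos]

/-! ### Sums of random signs -/

/-- The sign of a bit: `1` for `false` and `-1` for `true`. -/
def bitSign (b : Bool) : ℝ := if b then -1 else 1

@[simp] lemma bitSign_not (b : Bool) : bitSign (!b) = -bitSign b := by cases b <;> simp [bitSign]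

@[simp] lemma bitSign_mul_self (b : Bool) : bitSign b * bitSign b = 1 := by
  cases b <;> simp [bitSign]

lemma bitSign_mul (a b : Bool) : bitSign a * bitSign b = 1 - 2 * (if b ≠ a then 1 else 0) := by
  cases a <;> cases b <;> simp [bitSign] <;> norm_num

section Signs

variable {X : Type*} [DecidableEq X]

/-- The sum of the signs `h i`, `i ∈ s`, with weights `w`. -/
def signSum (s : Finset X) (w : X → ℝ) (h : X → Bool) : ℝ := ∑ i ∈ s, w i * bitSign (h i)

lemma signSum_update (s : Finset X) (w : X → ℝ) (h : X → Bool) {i : X} (hi : i ∉ s) (b : Bool) :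
    signSum s w (Function.update h i b) = signSum s w h := by
  refine Finset.sum_congr rfl fun j hj => ?_
  rw [Function.update_of_ne (by rintro rfl; exact hi hj)]

lemma signSum_insert {s : Finset X} (w : X → ℝ) (h : X → Bool) {i : X} (hi : i ∉ s) :
    signSum (insert i s) w h = w i * bitSign (h i) + signSum s w h := by
  rw [signSum, Finset.sum_insert hi]
  rfl

variable [Fintype X]

/-- A random sign averages out against a factor not depending on its bit. -/
lemma sum_mul_bitSign_eq_zero (F : (X → Bool) → ℝ) (i : X)
    (hF : ∀ h b, F (Function.update h i b) = F h) : ∑ h : X → Bool, F h * bitSign (h i) = 0 := by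
  have hinv : Function.Involutive fun h : X → Bool => Function.update h i (!h i) := by
    intro h
    simp
  have h1 := (Equiv.sum_comp (Function.Involutive.toPerm _ hinv) fun h => F h * bitSign (h i)).symm
  have h2 : ∀ h : X → Bool, F (Function.Involutive.toPerm _ hinv h) *
      bitSign (Function.Involutive.toPerm _ hinv h i) = -(F h * bitSign (h i)) := by
    intro h
    simp [Function.Involutive.toPerm, hF]
  simp only [h2, Finset.sum_neg_distrib] at h1
  linarith

lemma sum_signSum_sq (s : Finset X) (w : X → ℝ) :
    ∑ h : X → Bool, signSum s w h ^ 2 = Fintype.card (X → Bool) * ∑ i ∈ s, w i ^ 2 := by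
  induction s using Finset.induction_on with
  | empty => simp [signSum]
  | insert i s hi ih =>
    have h1 : ∀ h : X → Bool, signSum (insert i s) w h ^ 2 =
        w i ^ 2 + signSum s w h ^ 2 + 2 * w i * signSum s w h * bitSign (h i) := by
      intro h
      rw [signSum_insert w h hi]
      linear_combination w i ^ 2 * bitSign_mul_self (h i)
    simp only [h1, Finset.sum_add_distrib, ih]
    rw [sum_mul_bitSign_eq_zero (fun h => 2 * w i * signSum s w h) i
      (fun h b => by simp only [signSum_update s w h hi b]), Finset.sum_insert hi]
    simp
    ring

lemma sum_signSum_pow_four_le (s : Finset X) (w : X → ℝ) :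
    ∑ h : X → Bool, signSum s w h ^ 4 ≤
      Fintype.card (X → Bool) * (3 * (∑ i ∈ s, w i ^ 2) ^ 2) := by
  induction s using Finset.induction_on with
  | empty => simp [signSum]
  | insert i s hi ih =>
    have h1 : ∀ h : X → Bool, signSum (insert i s) w h ^ 4 =
        w i ^ 4 + 6 * w i ^ 2 * signSum s w h ^ 2 + signSum s w h ^ 4 +
          (4 * w i ^ 3 * signSum s w h + 4 * w i * signSum s w h ^ 3) * bitSign (h i) := by
      intro h
      rw [signSum_insert w h hi]
      have h2 := bitSign_mul_self (h i)
      linear_combination (w i ^ 4 * (bitSign (h i) ^ 2 + 1) +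
        4 * w i ^ 3 * signSum s w h * bitSign (h i) + 6 * w i ^ 2 * signSum s w h ^ 2) * h2
    simp only [h1, Finset.sum_add_distrib]
    rw [sum_mul_bitSign_eq_zero (fun h => 4 * w i ^ 3 * signSum s w h + 4 * w i * signSum s w h ^ 3)
      i (fun h b => by simp only [signSum_update s w h hi b]), Finset.sum_insert hi,
      ← Finset.mul_sum, sum_signSum_sq]
    simp only [Finset.sum_const, Finset.card_univ, nsmul_eq_mul]
    have : 0 ≤ (Fintype.card (X → Bool) : ℝ) * w i ^ 4 := by positivity
    nlinarith

/-- Khinchine's inequality in `L¹`, from the pointwise bound `u² - (4/27) u⁴ ≤ |u|`. -/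
lemma sum_abs_signSum_ge (s : Finset X) (w : X → ℝ) {v : ℝ} (hv : 0 < v)
    (hw : ∑ i ∈ s, w i ^ 2 = v ^ 2) :
    Fintype.card (X → Bool) * (5 / 9 * v) ≤ ∑ h : X → Bool, |signSum s w h| := by
  have hpt : ∀ x : ℝ, x ^ 2 / v - 4 / 27 * x ^ 4 / v ^ 3 ≤ |x| := by
    intro x
    obtain ⟨u, hu0, hu⟩ : ∃ u : ℝ, 0 ≤ u ∧ |x| = u * v :=
      ⟨|x| / v, by positivity, by field_simp⟩
    have h2 : x ^ 2 = (u * v) ^ 2 := by rw [← hu, sq_abs]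
    have h4 : x ^ 4 = (u * v) ^ 4 := by rw [← hu, show |x| ^ 4 = (|x| ^ 2) ^ 2 by ring, sq_abs]; ring
    rw [h2, h4, hu]
    have : (u * v) ^ 2 / v - 4 / 27 * (u * v) ^ 4 / v ^ 3 = v * (u ^ 2 - 4 / 27 * u ^ 4) := by
      field_simp
    rw [this, mul_comm u v]
    refine mul_le_mul_of_nonneg_left ?_ hv.le
    -- `1 + 4u³/27 - u = (4/27) (u - 3/2)² (u + 3)`
    nlinarith [mul_nonneg hu0 (mul_nonneg (sq_nonneg (u - 3 / 2)) (by linarith : 0 ≤ u + 3))]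
  have h1 := Finset.sum_le_sum fun h (_ : h ∈ (Finset.univ : Finset (X → Bool))) =>
    hpt (signSum s w h)
  refine le_trans ?_ h1
  rw [Finset.sum_sub_distrib, ← Finset.sum_div, ← Finset.sum_div, ← Finset.mul_sum,
    sum_signSum_sq, hw]
  have h4 := sum_signSum_pow_four_le s w
  rw [hw] at h4
  have h5 : 4 / 27 * ∑ h : X → Bool, signSum s w h ^ 4 ≤
      4 / 9 * Fintype.card (X → Bool) * v ^ 4 := by nlinarith
  have h6 : (4 / 27 * ∑ h : X → Bool, signSum s w h ^ 4) / v ^ 3 ≤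
      4 / 9 * Fintype.card (X → Bool) * v := by
    rw [div_le_iff₀ (by positivity)]
    nlinarith
  have h7 : Fintype.card (X → Bool) * v ^ 2 / v = Fintype.card (X → Bool) * v := by
    field_simp
  rw [h7]
  linarith

/-- Functions of disjoint sets of bits are uncorrelated. -/
lemma sum_mul_of_dependsOn {F G : (X → Bool) → ℝ} {D : Set X} (hF : DependsOn F D)
    (hG : DependsOn G Dᶜ) :
    Fintype.card (X → Bool) * ∑ h, F h * G h = (∑ h, F h) * ∑ h, G h := by
  classical
  let mix : (X → Bool) × (X → Bool) → (X → Bool) × (X → Bool) := fun p =>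
    (fun i => if i ∈ D then p.1 i else p.2 i, fun i => if i ∈ D then p.2 i else p.1 i)
  have hmix : Function.Involutive mix := by
    rintro ⟨a, b⟩
    simp only [mix, Prod.mk.injEq]
    constructor <;> ext i <;> by_cases hi : i ∈ D <;> simp [hi]
  have h1 : ∀ p : (X → Bool) × (X → Bool),
      F (Function.Involutive.toPerm _ hmix p).1 * G (Function.Involutive.toPerm _ hmix p).1 =
        F p.1 * G p.2 := by
    intro p
    congr 1
    · exact hF fun i hi => by simp [Function.Involutive.toPerm, mix, hi]
    · refine hG fun i hi => ?_
      simp only [Set.mem_compl_iff] at hi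
      simp [Function.Involutive.toPerm, mix, hi]
  have h2 := Equiv.sum_comp (Function.Involutive.toPerm _ hmix) fun p => F p.1 * G p.1
  simp only [h1] at h2
  rw [Fintype.sum_prod_type, Fintype.sum_prod_type] at h2
  rw [Finset.sum_mul_sum, h2]
  simp [Finset.mul_sum]

/-- Concentration (by Chebyshev's inequality) of a sum of independent terms `|signSum (D c) (w c)|`
with the same variance `v²`. -/
lemma card_sum_abs_signSum_lt {γ : Type*} (J : Finset γ) (D : γ → Finset X) (w : γ → X → ℝ)
    (hD : (J : Set γ).PairwiseDisjoint D) {v : ℝ} (hv : 0 < v)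
    (hw : ∀ c ∈ J, ∑ i ∈ D c, w c i ^ 2 = v ^ 2) :
    ((Finset.univ.filter fun h : X → Bool =>
      ∑ c ∈ J, |signSum (D c) (w c) h| < 5 / 18 * v * J.card).card : ℝ) * J.card ≤
      13 * Fintype.card (X → Bool) := by
  classical
  rcases J.eq_empty_or_nonempty with rfl | hJ
  · simp
  set N : ℝ := ((Fintype.card (X → Bool) : ℕ) : ℝ) with hN
  have hNpos : 0 < N := by rw [hN]; exact_mod_cast Fintype.card_pos
  have hJpos : (0 : ℝ) < J.card := by exact_mod_cast hJ.card_pos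
  let Y : γ → (X → Bool) → ℝ := fun c h => |signSum (D c) (w c) h|
  let μ : γ → ℝ := fun c => (∑ h, Y c h) / N
  have hμ : ∀ c ∈ J, 5 / 9 * v ≤ μ c := fun c hc => by
    rw [le_div_iff₀ hNpos, mul_comm]
    exact sum_abs_signSum_ge (D c) (w c) hv (hw c hc)
  have hdep : ∀ c, DependsOn (fun h => Y c h - μ c) (D c : Set X) := by
    intro c h h' hh
    simp only [Y, signSum]
    rw [Finset.sum_congr rfl fun i hi => by rw [hh i hi]]
  have hmean : ∀ c, ∑ h, (Y c h - μ c) = 0 := by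
    intro c
    rw [Finset.sum_sub_distrib]
    simp only [Finset.sum_const, Finset.card_univ, nsmul_eq_mul, ← hN, μ]
    field_simp
    ring
  have hvar : ∀ c ∈ J, ∑ h, (Y c h - μ c) * (Y c h - μ c) ≤ N * v ^ 2 := by
    intro c hc
    have h1 : ∑ h, (Y c h - μ c) * (Y c h - μ c) = ∑ h, Y c h ^ 2 - N * μ c ^ 2 := by
      have h2 : ∀ h, (Y c h - μ c) * (Y c h - μ c) =
          Y c h ^ 2 - 2 * μ c * (Y c h - μ c) - μ c ^ 2 := fun h => by ring
      simp only [h2]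
      rw [Finset.sum_sub_distrib, Finset.sum_sub_distrib, ← Finset.mul_sum, hmean c]
      simp [hN]
    rw [h1]
    have h3 : ∑ h, Y c h ^ 2 = N * v ^ 2 := by
      simp only [Y, sq_abs]
      rw [sum_signSum_sq, hw c hc]
    have : 0 ≤ N * μ c ^ 2 := by positivity
    linarith
  have hcov : ∀ c ∈ J, ∀ c' ∈ J, c ≠ c' → ∑ h, (Y c h - μ c) * (Y c' h - μ c') = 0 := by
    intro c hc c' hc' hne
    have h1 := sum_mul_of_dependsOn (hdep c) ((hdep c').mono (t := (D c : Set X)ᶜ) (by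
      rw [Set.subset_compl_iff_disjoint_left]
      exact_mod_cast hD hc hc' hne))
    rw [hmean c, zero_mul, ← hN] at h1
    exact (mul_eq_zero.1 h1).resolve_left hNpos.ne'
  have htot : ∑ h, (∑ c ∈ J, (Y c h - μ c)) ^ 2 ≤ J.card * (N * v ^ 2) := by
    simp only [sq, Finset.sum_mul_sum]
    rw [Finset.sum_comm, ← nsmul_eq_mul]
    refine Finset.sum_le_card_nsmul _ _ _ fun c hc => ?_
    rw [Finset.sum_comm, Finset.sum_eq_single_of_mem c hc
      fun c' hc' hne => hcov c hc c' hc' hne.symm, ← sq]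
    exact hvar c hc
  set B := Finset.univ.filter fun h : X → Bool =>
      ∑ c ∈ J, |signSum (D c) (w c) h| < 5 / 18 * v * J.card with hB
  have hlow : B.card * (5 / 18 * v * J.card) ^ 2 ≤ ∑ h, (∑ c ∈ J, (Y c h - μ c)) ^ 2 := by
    have h1 : ∀ h ∈ B, (5 / 18 * v * J.card) ^ 2 ≤ (∑ c ∈ J, (Y c h - μ c)) ^ 2 := by
      intro h hh
      have h2 : ∑ c ∈ J, Y c h < 5 / 18 * v * J.card := (Finset.mem_filter.1 hh).2
      have h3 : J.card * (5 / 9 * v) ≤ ∑ c ∈ J, μ c := by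
        rw [← nsmul_eq_mul]
        exact Finset.card_nsmul_le_sum _ _ _ hμ
      have h4 : ∑ c ∈ J, (Y c h - μ c) ≤ -(5 / 18 * v * J.card) := by
        rw [Finset.sum_sub_distrib]
        linarith
      have h5 : 0 ≤ 5 / 18 * v * J.card := by positivity
      nlinarith
    rw [← nsmul_eq_mul]
    exact (Finset.card_nsmul_le_sum _ _ _ h1).trans
      (Finset.sum_le_sum_of_subset_of_nonneg (Finset.subset_univ _) fun _ _ _ => sq_nonneg _)
  have hfin : (J.card * v ^ 2) * (B.card * J.card * (5 / 18) ^ 2) ≤ (J.card * v ^ 2) * N := by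
    nlinarith
  have := le_of_mul_le_mul_left hfin (by positivity)
  linarith

/-- The exponential moment of a sum of `s.card` independent signs. -/
lemma sum_exp_signSum_le (s : Finset X) (g : X → Bool) (l : ℝ) :
    ∑ h : X → Bool, Real.exp (l * signSum s (fun i => bitSign (g i)) h) ≤
      Fintype.card (X → Bool) * Real.exp (l ^ 2 / 2 * s.card) := by
  induction s using Finset.induction_on with
  | empty => simp [signSum]
  | insert i s hi ih =>
    set w : X → ℝ := fun i => bitSign (g i) with hw
    have h0 : ∀ a b : Bool, Real.exp (l * (bitSign a * bitSign b)) =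
        Real.cosh l + Real.sinh l * bitSign a * bitSign b := by
      intro a b
      cases a <;> cases b <;> simp [bitSign, Real.cosh_add_sinh, ← sub_eq_add_neg,
        Real.cosh_sub_sinh]
    have h1 : ∀ h : X → Bool, Real.exp (l * signSum (insert i s) w h) =
        Real.cosh l * Real.exp (l * signSum s w h) +
          (Real.sinh l * w i * Real.exp (l * signSum s w h)) * bitSign (h i) := by
      intro h
      rw [signSum_insert w h hi, mul_add, Real.exp_add, h0]
      ring
    simp only [h1, Finset.sum_add_distrib]
    rw [sum_mul_bitSign_eq_zero (fun h => Real.sinh l * w i * Real.exp (l * signSum s w h))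
      i (fun h b => by simp only [signSum_update s w h hi b]), ← Finset.mul_sum,
      Finset.card_insert_of_notMem hi, add_zero]
    calc _ ≤ Real.exp (l ^ 2 / 2) * (Fintype.card (X → Bool) * Real.exp (l ^ 2 / 2 * s.card)) :=
          mul_le_mul (Real.cosh_le_exp_half_sq l) ih
            (Finset.sum_nonneg fun _ _ => (Real.exp_pos _).le) (Real.exp_pos _).le
      _ = _ := by
        push_cast
        rw [mul_add, Real.exp_add]
        ring_nf

/-- Hoeffding's bound for a random function disagreeing with `g` on less than half of `Z` by a margin
of `s`; for empty `Z` the quotient is `0` and the bound is trivial. -/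
lemma card_disagree_lt_le (Z : Finset X) (g : X → Bool) {s : ℝ} (hs : 0 ≤ s) :
    ((Finset.univ.filter fun h : X → Bool =>
      ((Z.filter fun x => h x ≠ g x).card : ℝ) < Z.card / 2 - s).card : ℝ) ≤
      Fintype.card (X → Bool) * Real.exp (-(2 * s ^ 2 / Z.card)) := by
  set B := Finset.univ.filter fun h : X → Bool =>
      ((Z.filter fun x => h x ≠ g x).card : ℝ) < Z.card / 2 - s with hB
  set l : ℝ := 2 * s / Z.card with hl
  have hcount : ∀ h : X → Bool, signSum Z (fun x => bitSign (g x)) h =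
      Z.card - 2 * (Z.filter fun x => h x ≠ g x).card := by
    intro h
    simp only [signSum, bitSign_mul, Finset.sum_sub_distrib, ← Finset.mul_sum, Finset.sum_boole]
    simp
  have h1 : B.card * Real.exp (l * (2 * s)) ≤
      Fintype.card (X → Bool) * Real.exp (l ^ 2 / 2 * Z.card) := by
    refine le_trans ?_ (sum_exp_signSum_le Z g l)
    rw [← nsmul_eq_mul]
    refine (Finset.card_nsmul_le_sum B (fun h => Real.exp (l * signSum Z (fun x => bitSign (g x)) h))
      _ fun h hh => ?_).trans
      (Finset.sum_le_sum_of_subset_of_nonneg (Finset.subset_univ _) fun _ _ _ => (Real.exp_pos _).le)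
    have h2 := (Finset.mem_filter.1 hh).2
    refine Real.exp_le_exp.2 (mul_le_mul_of_nonneg_left ?_ (by positivity))
    rw [hcount h]
    linarith
  rw [← le_div_iff₀ (Real.exp_pos _), mul_div_assoc, ← Real.exp_sub] at h1
  refine h1.trans_eq ?_
  congr 2
  rcases Nat.eq_zero_or_pos Z.card with h0 | h0
  · simp [hl, h0]
  · have : (0 : ℝ) < Z.card := by exact_mod_cast h0
    rw [hl]
    field_simp
    ring

end Signs

/-! ### A random function is far from juntas -/

lemma card_filter_restrict_eq {n : ℕ} (S : Finset (Fin n)) (c : S → Bool) :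
    (Finset.univ.filter fun x : Fin n → Bool => S.restrict x = c).card = 2 ^ (n - S.card) := by
  classical
  have h : (Finset.univ.filter fun x : Fin n → Bool => S.restrict x = c) =
      Fintype.piFinset fun i => if hi : i ∈ S then {c ⟨i, hi⟩} else Finset.univ := by
    ext x
    simp only [Finset.mem_filter, Finset.mem_univ, true_and, Fintype.mem_piFinset]
    constructor
    · rintro rfl i
      by_cases hi : i ∈ S <;> simp [hi]
    · intro hx
      ext ⟨i, hi⟩
      have := hx i
      simpa [hi] using this
  rw [h, Fintype.card_piFinset]
  have h2 : ∀ i : Fin n, (if hi : i ∈ S then {c ⟨i, hi⟩} else (Finset.univ : Finset Bool)).card =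
      if i ∈ Sᶜ then 2 else 1 := by
    intro i
    by_cases hi : i ∈ S <;> simp [hi]
  simp only [h2]
  rw [Finset.prod_ite_mem, Finset.univ_inter, Finset.prod_const, Finset.card_compl,
    Fintype.card_fin]

/-- The cells of the partition according to the coordinates in `S` more than half of whose points
lie in `Z`. -/
def heavyCells {n : ℕ} (Z : Finset (Fin n → Bool)) (S : Finset (Fin n)) : Finset (S → Bool) :=
  Finset.univ.filter fun c => 2 ^ (n - S.card) < 2 * (Z.filter fun x => S.restrict x = c).card

lemma card_heavyCells_mul_le {n : ℕ} (Z : Finset (Fin n → Bool)) (S : Finset (Fin n)) :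
    (heavyCells Z S).card * 2 ^ (n - S.card) ≤ 2 * Z.card := by
  have h1 : (heavyCells Z S).card * 2 ^ (n - S.card) ≤
      ∑ c ∈ heavyCells Z S, 2 * (Z.filter fun x => S.restrict x = c).card := by
    rw [← smul_eq_mul]
    exact Finset.card_nsmul_le_sum _ _ _ fun c hc => (Finset.mem_filter.1 hc).2.le
  refine h1.trans ?_
  rw [← Finset.mul_sum]
  gcongr
  rw [Finset.card_eq_sum_card_fiberwise (f := S.restrict) (t := Finset.univ) (by simp)]
  exact Finset.sum_le_sum_of_subset (Finset.subset_univ _)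

/-- For a function vanishing off `Z`, the best approximation depending only on the coordinates in
`S` may be taken to vanish on every cell that is not heavy. -/
lemma exists_heavy_approx {n : ℕ} (Z : Finset (Fin n → Bool)) (h : BoolFun n)
    (S : Finset (Fin n)) (g : BoolFun n) (hg : DependsOn g (S : Set (Fin n))) :
    ∃ G ⊆ heavyCells Z S, hammingDist (maskTo Z h) (fun x => decide (S.restrict x ∈ G)) ≤
      hammingDist (maskTo Z h) g := by
  classical
  obtain ⟨g', hg'⟩ := dependsOn_iff_exists_comp.1 hg
  have hgx : ∀ x, g x = g' (S.restrict x) := fun x => by rw [hg']; rfl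
  refine ⟨(heavyCells Z S).filter fun c => g' c = true, Finset.filter_subset _ _, ?_⟩
  simp only [hammingDist]
  rw [Finset.card_eq_sum_card_fiberwise (f := S.restrict) (t := Finset.univ) (by simp),
    Finset.card_eq_sum_card_fiberwise (f := S.restrict) (t := Finset.univ) (by simp)]
  refine Finset.sum_le_sum fun c _ => ?_
  by_cases hc : c ∈ heavyCells Z S ∨ g' c = false
  · refine Finset.card_le_card fun x hx => ?_
    simp only [Finset.mem_filter, Finset.mem_univ, true_and, hgx] at hx ⊢
    obtain ⟨hx, rfl⟩ := hx
    refine ⟨?_, rfl⟩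
    rcases hc with hc | hc
    · simpa [hc] using hx
    · simpa [hc] using hx
  · -- on a light cell where `g` is `true`, it disagrees off `Z`, so on at least half of the cell
    push Not at hc
    obtain ⟨hc, hgc⟩ := hc
    have hgc' : g' c = true := by simpa using hgc
    have hlight : 2 * (Z.filter fun x => S.restrict x = c).card ≤ 2 ^ (n - S.card) := by
      simpa [heavyCells] using hc
    set K := Finset.univ.filter fun x : Fin n → Bool => S.restrict x = c with hK
    have hsplit := Finset.card_filter_add_card_filter_not (s := K) fun x => x ∈ Z
    rw [card_filter_restrict_eq] at hsplit
    have hKZ : (K.filter fun x => x ∈ Z) = Z.filter fun x => S.restrict x = c := by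
      ext x
      simp [hK, and_comm]
    rw [hKZ] at hsplit
    have hmid : (Z.filter fun x => S.restrict x = c).card ≤ (K.filter fun x => ¬ x ∈ Z).card := by
      omega
    refine (Finset.card_le_card fun x hx => ?_).trans (hmid.trans (Finset.card_le_card fun x hx => ?_))
    · simp only [Finset.mem_filter, Finset.mem_univ, true_and] at hx ⊢
      obtain ⟨hx, rfl⟩ := hx
      by_contra hxZ
      simp [maskTo, hc] at hx
      simp [hx] at hxZ
    · simp only [hK, Finset.mem_filter, Finset.mem_univ, true_and, hgx] at hx ⊢
      obtain ⟨rfl, hx⟩ := hx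
      simp [maskTo, hx, hgc']

open Classical in
/-- Union bound over all sets `S` of at most `k` coordinates and all sets of heavy cells. -/
lemma card_not_isFarFromJuntas_le {n k : ℕ} (Z : Finset (Fin n → Bool)) {ε s : ℝ} (hs : 0 ≤ s)
    (hε : ε * 2 ^ n ≤ Z.card / 2 - s) :
    ((Finset.univ.filter fun h : BoolFun n => ¬ IsFarFromJuntas k ε (maskTo Z h)).card : ℝ) ≤
      2 ^ n * 2 ^ (2 * Z.card / 2 ^ (n - k) : ℝ) * Real.exp (-(2 * s ^ 2 / Z.card)) *
        Fintype.card (BoolFun n) := by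
  set E : ℝ := Fintype.card (BoolFun n) * Real.exp (-(2 * s ^ 2 / Z.card)) with hE
  have hE0 : 0 ≤ E := by positivity
  let bad : (S : Finset (Fin n)) → Finset (S → Bool) → Finset (BoolFun n) := fun S G =>
    Finset.univ.filter fun h => ((Z.filter fun x => h x ≠ decide (S.restrict x ∈ G)).card : ℝ) <
      Z.card / 2 - s
  let small : Finset (Finset (Fin n)) := Finset.univ.filter fun S => S.card ≤ k
  have hsub : (Finset.univ.filter fun h : BoolFun n => ¬ IsFarFromJuntas k ε (maskTo Z h)) ⊆
      small.biUnion fun S => (heavyCells Z S).powerset.biUnion fun G => bad S G := by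
    intro h hh
    simp only [IsFarFromJuntas, Finset.mem_filter, Finset.mem_univ, true_and, not_forall,
      not_le] at hh
    obtain ⟨g, ⟨S, hS, hgS⟩, hlt⟩ := hh
    obtain ⟨G, hG, hle⟩ := exists_heavy_approx Z h S g hgS
    simp only [Finset.mem_biUnion, Finset.mem_powerset]
    refine ⟨S, by simp [small, hS], G, hG, ?_⟩
    simp only [bad, Finset.mem_filter, Finset.mem_univ, true_and]
    have h1 : (Z.filter fun x => h x ≠ decide (S.restrict x ∈ G)).card ≤
        hammingDist (maskTo Z h) (fun x => decide (S.restrict x ∈ G)) := by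
      refine Finset.card_le_card fun x hx => ?_
      simp only [Finset.mem_filter, Finset.mem_univ, true_and] at hx ⊢
      simpa [maskTo, hx.1] using hx.2
    have h2 : ((Z.filter fun x => h x ≠ decide (S.restrict x ∈ G)).card : ℝ) ≤
        hammingDist (maskTo Z h) g := by exact_mod_cast h1.trans hle
    linarith
  have hbad : ∀ S G, ((bad S G).card : ℝ) ≤ E := fun S G =>
    card_disagree_lt_le Z (fun x => decide (S.restrict x ∈ G)) hs
  have hheavy : ∀ S ∈ small, (((heavyCells Z S).powerset.card : ℕ) : ℝ) ≤
      2 ^ (2 * Z.card / 2 ^ (n - k) : ℝ) := by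
    intro S hS
    rw [Finset.card_powerset]
    push_cast
    rw [← Real.rpow_natCast]
    refine Real.rpow_le_rpow_of_exponent_le (by norm_num) ?_
    rw [le_div_iff₀ (by positivity)]
    have h1 : ((heavyCells Z S).card : ℝ) * 2 ^ (n - S.card) ≤ 2 * Z.card := by
      exact_mod_cast card_heavyCells_mul_le Z S
    refine le_trans ?_ h1
    have hSk : S.card ≤ k := (Finset.mem_filter.1 hS).2
    gcongr
    norm_num
  have h1 : ((Finset.univ.filter fun h : BoolFun n =>
      ¬ IsFarFromJuntas k ε (maskTo Z h)).card : ℝ) ≤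
      ∑ S ∈ small, ∑ G ∈ (heavyCells Z S).powerset, ((bad S G).card : ℝ) := by
    exact_mod_cast (Finset.card_le_card hsub).trans (Finset.card_biUnion_le.trans
      (Finset.sum_le_sum fun S _ => Finset.card_biUnion_le))
  have h2 : ∀ S ∈ small, ∑ G ∈ (heavyCells Z S).powerset, ((bad S G).card : ℝ) ≤
      2 ^ (2 * Z.card / 2 ^ (n - k) : ℝ) * E := fun S hS =>
    (Finset.sum_le_card_nsmul _ _ _ fun G _ => hbad S G).trans <| by
      rw [nsmul_eq_mul]
      exact mul_le_mul_of_nonneg_right (hheavy S hS) hE0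
  have h3 : (small.card : ℝ) ≤ 2 ^ n := by
    have : small.card ≤ 2 ^ n := by
      simpa using Finset.card_le_univ small
    exact_mod_cast this
  calc _ ≤ ∑ S ∈ small, ∑ G ∈ (heavyCells Z S).powerset, ((bad S G).card : ℝ) := h1
    _ ≤ small.card • (2 ^ (2 * Z.card / 2 ^ (n - k) : ℝ) * E) := Finset.sum_le_card_nsmul _ _ _ h2
    _ ≤ 2 ^ n * (2 ^ (2 * Z.card / 2 ^ (n - k) : ℝ) * E) := by
      rw [nsmul_eq_mul]
      gcongr
    _ = _ := by rw [hE]; ring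

/-! ### Merging points along hidden blocks -/

section Blocks

variable {n m : ℕ}

/-- Two points agree up to complementing some of the blocks `σ i`: they agree off the blocks and,
on every block, they agree everywhere or nowhere. -/
def BlockEquiv (σ : Fin m → Finset (Fin n)) (x y : Fin n → Bool) : Prop :=
  (∀ j, (∀ i, j ∉ σ i) → x j = y j) ∧
    ∀ i, ∀ j ∈ σ i, ∀ j' ∈ σ i, xor (x j) (y j) = xor (x j') (y j')

/-- The points of the cube up to complementing blocks. -/
def blockSetoid (σ : Fin m → Finset (Fin n)) : Setoid (Fin n → Bool) where
  r := BlockEquiv σ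
  iseqv :=
    { refl := fun x => ⟨fun _ _ => rfl, by simp⟩
      symm := fun {x y} h => ⟨fun j hj => (h.1 j hj).symm, fun i j hj j' hj' => by
        rw [Bool.xor_comm, h.2 i j hj j' hj', Bool.xor_comm]⟩
      trans := fun {x y z} h h' => ⟨fun j hj => (h.1 j hj).trans (h'.1 j hj),
        fun i j hj j' hj' => by
          have h1 := h.2 i j hj j' hj'
          have h2 := h'.2 i j hj j' hj'
          revert h1 h2
          cases x j <;> cases y j <;> cases z j <;> cases x j' <;> cases y j' <;> cases z j' <;>
            simp⟩ }

/-- A choice of representative in each class of points up to complementing blocks. -/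
noncomputable def blockRep (σ : Fin m → Finset (Fin n)) (x : Fin n → Bool) : Fin n → Bool :=
  Quotient.out (Quotient.mk (blockSetoid σ) x)

lemma blockRep_eq_iff (σ : Fin m → Finset (Fin n)) (x y : Fin n → Bool) :
    blockRep σ x = blockRep σ y ↔ BlockEquiv σ x y := by
  rw [blockRep, blockRep, Quotient.out_inj]
  exact Quotient.eq (r := blockSetoid σ)

lemma blockEquiv_blockRep (σ : Fin m → Finset (Fin n)) (x : Fin n → Bool) :
    BlockEquiv σ (blockRep σ x) x :=
  Quotient.mk_out (s := blockSetoid σ) x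

/-- The coordinates outside all blocks. -/
def outsideBlocks (σ : Fin m → Finset (Fin n)) : Finset (Fin n) := (Finset.univ.biUnion σ)ᶜ

lemma BlockEquiv.restrict_eq {σ : Fin m → Finset (Fin n)} {x y : Fin n → Bool}
    (h : BlockEquiv σ x y) : (outsideBlocks σ).restrict x = (outsideBlocks σ).restrict y := by
  ext ⟨j, hj⟩
  simp only [outsideBlocks, Finset.mem_compl, Finset.mem_biUnion, Finset.mem_univ, true_and,
    not_exists] at hj
  exact h.1 j hj

/-- Every class has `2 ^ m` points, one for each set of blocks to complement. -/
lemma card_blockEquiv {σ : Fin m → Finset (Fin n)} (hσ : ∀ i, (σ i).Nonempty)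
    (hdisj : ∀ i i', i ≠ i' → Disjoint (σ i) (σ i')) (x : Fin n → Bool) :
    (Finset.univ.filter fun y => blockRep σ y = blockRep σ x).card = 2 ^ m := by
  classical
  choose e he using hσ
  have huniq : ∀ i i' j, j ∈ σ i → j ∈ σ i' → i = i' := by
    intro i i' j hj hj'
    by_contra hne
    exact Finset.disjoint_left.1 (hdisj i i' hne) hj hj'
  have hcard : (Finset.univ : Finset (Fin m → Bool)).card = 2 ^ m := by simp
  rw [← hcard]
  refine Finset.card_nbij' (fun y i => xor (y (e i)) (x (e i)))
    (fun u j => xor (x j) (decide (∃ i, j ∈ σ i ∧ u i = true))) (by simp) ?_ ?_ ?_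
  · intro u _
    simp only [Finset.coe_filter, Finset.mem_univ, true_and, Set.mem_ofPred_eq, blockRep_eq_iff]
    refine ⟨fun j hj => by simp [hj], fun i j hj j' hj' => ?_⟩
    have h1 : ∀ j ∈ σ i, (∃ i, j ∈ σ i ∧ u i = true) ↔ u i = true := fun j hj =>
      ⟨fun ⟨i', hi', hu⟩ => huniq i i' j hj hi' ▸ hu, fun hu => ⟨i, hj, hu⟩⟩
    simp only [h1 j hj, h1 j' hj']
    cases x j <;> cases x j' <;> simp
  · intro y hy
    simp only [Finset.coe_filter, Finset.mem_univ, true_and, Set.mem_ofPred_eq,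
      blockRep_eq_iff] at hy
    ext j
    by_cases hj : ∃ i, j ∈ σ i
    · obtain ⟨i, hi⟩ := hj
      have h1 : (∃ i, j ∈ σ i ∧ xor (y (e i)) (x (e i)) = true) ↔ xor (y j) (x j) = true :=
        ⟨fun ⟨i', hi', hu⟩ => by rwa [hy.2 i' j hi' _ (he i')],
          fun hu => ⟨i, hi, by rwa [← hy.2 i j hi _ (he i)]⟩⟩
      simp only [h1]
      cases x j <;> cases y j <;> simp
    · push Not at hj
      simp [hj, hy.1 j hj]
  · intro u _
    ext i
    have h1 : (∃ i', e i ∈ σ i' ∧ u i' = true) ↔ u i = true :=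
      ⟨fun ⟨i', hi', hu⟩ => huniq i i' _ (he i) hi' ▸ hu, fun hu => ⟨i, he i, hu⟩⟩
    simp only [h1]
    cases x (e i) <;> cases u i <;> simp

/-- The possible block systems: one `b`-subset of each part `P i`. -/
def blockSystems (P : Fin m → Finset (Fin n)) (b : ℕ) : Finset (Fin m → Finset (Fin n)) :=
  Fintype.piFinset fun i => (P i).powersetCard b

/-- Two distinct points are merged only if, in the part of a coordinate where they differ, the
block is exactly the set of coordinates where they differ. -/
lemma card_blockRep_eq_le {P : Fin m → Finset (Fin n)} {b M : ℕ} (hP : ∀ i, (P i).card = M)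
    (hdisj : ∀ i i', i ≠ i' → Disjoint (P i) (P i')) (hbM : b ≤ M) {x y : Fin n → Bool}
    (hxy : x ≠ y) :
    (((blockSystems P b).filter fun σ => blockRep σ x = blockRep σ y).card : ℝ) ≤
      (M.choose b : ℝ)⁻¹ * (blockSystems P b).card := by
  classical
  obtain ⟨d, hd⟩ := Function.ne_iff.1 hxy
  have hchoose : (0 : ℝ) < M.choose b := by exact_mod_cast Nat.choose_pos hbM
  have key : ∀ σ ∈ (blockSystems P b).filter fun σ => blockRep σ x = blockRep σ y,
      ∃ i, d ∈ P i ∧ σ i = (P i).filter fun j => x j ≠ y j := by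
    intro σ hσ
    simp only [Finset.mem_filter, blockRep_eq_iff, blockSystems, Fintype.mem_piFinset,
      Finset.mem_powersetCard] at hσ
    obtain ⟨hσ, hoff, hon⟩ := hσ
    obtain ⟨i, hi⟩ : ∃ i, d ∈ σ i := by
      by_contra hcon
      push Not at hcon
      exact hd (hoff d hcon)
    refine ⟨i, (hσ i).1 hi, ?_⟩
    ext j
    simp only [Finset.mem_filter]
    constructor
    · intro hj
      refine ⟨(hσ i).1 hj, ?_⟩
      have := hon i j hj d hi
      revert this hd
      cases x j <;> cases y j <;> cases x d <;> cases y d <;> simp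
    · rintro ⟨hjP, hj⟩
      by_contra hjσ
      refine hj (hoff j fun i' hi' => ?_)
      by_cases hii : i = i'
      · exact hjσ (hii ▸ hi')
      · exact Finset.disjoint_left.1 (hdisj i i' hii) hjP ((hσ i').1 hi')
  rcases Finset.eq_empty_or_nonempty
    ((blockSystems P b).filter fun σ => blockRep σ x = blockRep σ y) with h0 | ⟨σ₀, hσ₀⟩
  · rw [h0]
    simp only [Finset.card_empty, Nat.cast_zero]
    positivity
  · obtain ⟨i, hi, hσi⟩ := key σ₀ hσ₀
    have hmem : ((P i).filter fun j => x j ≠ y j) ∈ (P i).powersetCard b := by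
      rw [← hσi]
      exact (Fintype.mem_piFinset.1 (Finset.mem_filter.1 hσ₀).1) i
    have hsub : ((blockSystems P b).filter fun σ => blockRep σ x = blockRep σ y) ⊆
        (blockSystems P b).filter fun σ => σ i = (P i).filter fun j => x j ≠ y j := by
      intro σ hσ
      obtain ⟨i', hi', hσi'⟩ := key σ hσ
      have hii : i' = i := by
        by_contra hne
        exact Finset.disjoint_left.1 (hdisj i' i hne) hi' hi
      subst hii
      exact Finset.mem_filter.2 ⟨(Finset.mem_filter.1 hσ).1, hσi'⟩
    have hcard : ((blockSystems P b).filter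
        fun σ => σ i = (P i).filter fun j => x j ≠ y j).card * M.choose b =
        (blockSystems P b).card := by
      rw [blockSystems,
        Fintype.card_filter_piFinset_eq_of_mem (fun i => (P i).powersetCard b) i hmem,
        Fintype.card_piFinset,
        ← Finset.prod_erase_mul _ _ (Finset.mem_univ i), Finset.card_powersetCard (n := b) (s := P i),
        hP i]
    rw [inv_mul_eq_div, le_div_iff₀ hchoose, ← hcard]
    push_cast
    gcongr

end Blocks

/-! ### A merged random function is close to juntas -/

section Close

variable {n m : ℕ}

/-- The points whose coordinates in `S` are given by `c`. -/
def cell (S : Finset (Fin n)) (c : S → Bool) : Finset (Fin n → Bool) :=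
  Finset.univ.filter fun x => S.restrict x = c

lemma mem_cell {S : Finset (Fin n)} {c : S → Bool} {x : Fin n → Bool} :
    x ∈ cell S c ↔ S.restrict x = c := by simp [cell]

/-- The number of points of the class of `r` in the cell `c`, for a representative `r`. -/
noncomputable def cellWeight (σ : Fin m → Finset (Fin n)) (c : outsideBlocks σ → Bool)
    (r : Fin n → Bool) : ℝ :=
  ((cell (outsideBlocks σ) c).filter fun x => blockRep σ x = r).card

lemma blockRep_mem_cell {σ : Fin m → Finset (Fin n)} {c : outsideBlocks σ → Bool}
    {x : Fin n → Bool} (hx : x ∈ cell (outsideBlocks σ) c) :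
    blockRep σ x ∈ cell (outsideBlocks σ) c := by
  rw [mem_cell] at hx ⊢
  rw [← hx, (blockEquiv_blockRep σ x).restrict_eq]

lemma signSum_cellWeight (σ : Fin m → Finset (Fin n)) (c : outsideBlocks σ → Bool)
    (h : BoolFun n) :
    signSum (cell (outsideBlocks σ) c) (cellWeight σ c) h =
      ∑ x ∈ cell (outsideBlocks σ) c, bitSign (h (blockRep σ x)) := by
  rw [signSum, ← Finset.sum_fiberwise_of_maps_to
    (t := cell (outsideBlocks σ) c) (g := blockRep σ) (fun x hx => blockRep_mem_cell hx)
    fun x => bitSign (h (blockRep σ x))]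
  refine Finset.sum_congr rfl fun r _ => ?_
  rw [Finset.sum_congr rfl fun x hx => by rw [(Finset.mem_filter.1 hx).2], Finset.sum_const,
    nsmul_eq_mul, cellWeight]

lemma sum_cellWeight_sq {σ : Fin m → Finset (Fin n)} (hσ : ∀ i, (σ i).Nonempty)
    (hdisj : ∀ i i', i ≠ i' → Disjoint (σ i) (σ i')) (c : outsideBlocks σ → Bool) :
    ∑ r ∈ cell (outsideBlocks σ) c, cellWeight σ c r ^ 2 =
      2 ^ (n - (outsideBlocks σ).card) * 2 ^ m := by
  have h1 : ∑ r ∈ cell (outsideBlocks σ) c, cellWeight σ c r ^ 2 =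
      ∑ x ∈ cell (outsideBlocks σ) c, cellWeight σ c (blockRep σ x) := by
    rw [← Finset.sum_fiberwise_of_maps_to
      (t := cell (outsideBlocks σ) c) (g := blockRep σ) (fun x hx => blockRep_mem_cell hx)
      fun x => cellWeight σ c (blockRep σ x)]
    refine Finset.sum_congr rfl fun r _ => ?_
    rw [Finset.sum_congr rfl fun x hx => by rw [(Finset.mem_filter.1 hx).2], Finset.sum_const,
      nsmul_eq_mul, sq, cellWeight]
  have h2 : ∀ x ∈ cell (outsideBlocks σ) c, cellWeight σ c (blockRep σ x) = 2 ^ m := by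
    intro x hx
    have h3 : ((cell (outsideBlocks σ) c).filter fun y => blockRep σ y = blockRep σ x) =
        Finset.univ.filter fun y => blockRep σ y = blockRep σ x := by
      ext y
      simp only [Finset.mem_filter, Finset.mem_univ, true_and, and_iff_right_iff_imp]
      intro hy
      rw [blockRep_eq_iff] at hy
      rw [mem_cell] at hx ⊢
      rw [hy.restrict_eq, hx]
    rw [cellWeight, h3, card_blockEquiv hσ hdisj]
    push_cast
    rfl
  rw [h1, Finset.sum_congr rfl h2, Finset.sum_const, nsmul_eq_mul, cell, card_filter_restrict_eq]
  push_cast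
  rfl

lemma card_image_restrict_mul {S : Finset (Fin n)} {Z : Finset (Fin n → Bool)}
    (hZ : ∀ x y, S.restrict x = S.restrict y → (x ∈ Z ↔ y ∈ Z)) :
    (Z.image S.restrict).card * 2 ^ (n - S.card) = Z.card := by
  rw [Finset.card_eq_sum_card_image S.restrict Z, ← smul_eq_mul, ← Finset.sum_const]
  refine Finset.sum_congr rfl fun c hc => ?_
  rw [← card_filter_restrict_eq S c]
  congr 1
  ext x
  obtain ⟨y, hy, rfl⟩ := Finset.mem_image.1 hc
  simp only [Finset.mem_filter, Finset.mem_univ, true_and]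
  exact ⟨fun h => ⟨(hZ x y h).2 hy, h⟩, fun h => h.2⟩

/-- Taking the majority value on each cell, the merged function is approximated better the larger
the sums of its signs over the cells are. -/
lemma exists_junta_hammingDist (σ : Fin m → Finset (Fin n)) {Z : Finset (Fin n → Bool)}
    (hZ : ∀ x y, (outsideBlocks σ).restrict x = (outsideBlocks σ).restrict y → (x ∈ Z ↔ y ∈ Z))
    (h : BoolFun n) : ∃ g : BoolFun n, DependsOn g (outsideBlocks σ : Set (Fin n)) ∧
      2 * (hammingDist (maskTo Z (h ∘ blockRep σ)) g : ℝ) =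
        Z.card - ∑ c ∈ Z.image (outsideBlocks σ).restrict,
          |signSum (cell (outsideBlocks σ) c) (cellWeight σ c) h| := by
  classical
  set S := outsideBlocks σ with hS
  let Y : (S → Bool) → ℝ := fun c => signSum (cell S c) (cellWeight σ c) h
  refine ⟨fun x => decide (x ∈ Z) && decide (Y (S.restrict x) < 0), ?_, ?_⟩
  · intro x y hxy
    have h1 : S.restrict x = S.restrict y := Finset.dependsOn_restrict S hxy
    simp only [h1, hZ x y h1]
  · have h1 : hammingDist (maskTo Z (h ∘ blockRep σ))
        (fun x => decide (x ∈ Z) && decide (Y (S.restrict x) < 0)) =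
        (Z.filter fun x => h (blockRep σ x) ≠ decide (Y (S.restrict x) < 0)).card := by
      rw [hammingDist]
      congr 1
      ext x
      rw [Finset.mem_filter, Finset.mem_filter]
      by_cases hx : x ∈ Z <;> simp [maskTo, hx]
    have h2 : ∀ c, |Y c| = ∑ x ∈ cell S c, bitSign (decide (Y c < 0)) * bitSign (h (blockRep σ x)) := by
      intro c
      rw [← Finset.mul_sum, ← signSum_cellWeight]
      change |Y c| = _ * Y c
      by_cases hc : Y c < 0
      · simp [hc, bitSign, abs_of_neg hc]
      · simp [hc, bitSign, abs_of_nonneg (not_lt.1 hc)]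
    have h3 : ∑ c ∈ Z.image S.restrict, |Y c| = ∑ x ∈ Z,
        bitSign (decide (Y (S.restrict x) < 0)) * bitSign (h (blockRep σ x)) := by
      rw [← Finset.sum_fiberwise_of_maps_to (s := Z) (t := Z.image S.restrict) (g := S.restrict)
        fun x hx => Finset.mem_image_of_mem _ hx]
      refine Finset.sum_congr rfl fun c hc => ?_
      have h4 : Z.filter (fun x => S.restrict x = c) = cell S c := by
        ext x
        obtain ⟨y, hy, rfl⟩ := Finset.mem_image.1 hc
        rw [mem_cell, Finset.mem_filter]
        exact ⟨fun h => h.2, fun h => ⟨(hZ x y h).2 hy, h⟩⟩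
      rw [h2, h4]
      refine Finset.sum_congr rfl fun x hx => ?_
      rw [mem_cell.1 hx]
    change _ = (Z.card : ℝ) - ∑ c ∈ Z.image S.restrict, |Y c|
    rw [h1, h3]
    simp only [bitSign_mul, Finset.sum_sub_distrib, ← Finset.mul_sum, Finset.sum_boole]
    simp

open Classical in
lemma card_not_isCloseToJuntas_le {k : ℕ} {ε v : ℝ} {σ : Fin m → Finset (Fin n)}
    (hσ : ∀ i, (σ i).Nonempty) (hdisj : ∀ i i', i ≠ i' → Disjoint (σ i) (σ i'))
    (hk : (outsideBlocks σ).card ≤ k) {Z : Finset (Fin n → Bool)}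
    (hZ : ∀ x y, (outsideBlocks σ).restrict x = (outsideBlocks σ).restrict y → (x ∈ Z ↔ y ∈ Z))
    (hv : 0 < v) (hv2 : v ^ 2 = 2 ^ (n - (outsideBlocks σ).card) * 2 ^ m)
    (hε : Z.card - 5 / 18 * v * (Z.card / 2 ^ (n - (outsideBlocks σ).card)) ≤ 2 * (ε * 2 ^ n))
    (hlarge : (260 : ℝ) ≤ Z.card / 2 ^ (n - (outsideBlocks σ).card)) :
    ((Finset.univ.filter fun h : BoolFun n =>
      ¬ IsCloseToJuntas k ε (maskTo Z (h ∘ blockRep σ))).card : ℝ) ≤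
        1 / 20 * Fintype.card (BoolFun n) := by
  set S := outsideBlocks σ with hS
  set J := Z.image S.restrict with hJ
  have hJcard : (J.card : ℝ) = Z.card / 2 ^ (n - S.card) := by
    rw [eq_div_iff (by positivity)]
    exact_mod_cast card_image_restrict_mul hZ
  rw [← hJcard] at hε hlarge
  have hdis : (J : Set (S → Bool)).PairwiseDisjoint (cell S) := by
    intro c _ c' _ hne
    refine Finset.disjoint_left.2 fun x hx hx' => hne ?_
    rw [mem_cell] at hx hx'
    rw [← hx, hx']
  have hcheb := card_sum_abs_signSum_lt J (cell S) (cellWeight σ) hdis hv fun c _ => by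
    rw [sum_cellWeight_sq hσ hdisj, hv2]
  have hsub : (Finset.univ.filter fun h : BoolFun n =>
      ¬ IsCloseToJuntas k ε (maskTo Z (h ∘ blockRep σ))) ⊆
      Finset.univ.filter fun h : BoolFun n =>
        ∑ c ∈ J, |signSum (cell S c) (cellWeight σ c) h| < 5 / 18 * v * J.card := by
    intro h hh
    simp only [Finset.mem_filter, Finset.mem_univ, true_and] at hh ⊢
    by_contra hcon
    push Not at hcon
    obtain ⟨g, hg, hdist⟩ := exists_junta_hammingDist σ hZ h
    exact hh ⟨g, ⟨S, hk, hg⟩, by linarith⟩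
  have h1 := (Nat.cast_le (α := ℝ)).2 (Finset.card_le_card hsub)
  have h2 : (0 : ℝ) ≤ Fintype.card (BoolFun n) := by positivity
  set B := ((Finset.univ.filter fun h : BoolFun n =>
        ∑ c ∈ J, |signSum (cell S c) (cellWeight σ c) h| < 5 / 18 * v * J.card).card : ℝ) with hB
  have h3 : 0 ≤ B := by positivity
  have h4 : B * 260 ≤ B * J.card := by gcongr
  linarith

/-- If the blocks are singletons, then merging leaves no dependence on the coordinates in the
blocks. -/
lemma isCloseToJuntas_of_card_one {k : ℕ} {ε : ℝ} (hε : 0 ≤ ε) {σ : Fin m → Finset (Fin n)}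
    (hσ : ∀ i, (σ i).card = 1) (hk : (outsideBlocks σ).card ≤ k) {Z : Finset (Fin n → Bool)}
    (hZ : ∀ x y, (outsideBlocks σ).restrict x = (outsideBlocks σ).restrict y → (x ∈ Z ↔ y ∈ Z))
    (h : BoolFun n) : IsCloseToJuntas k ε (maskTo Z (h ∘ blockRep σ)) := by
  refine ⟨maskTo Z (h ∘ blockRep σ), ⟨outsideBlocks σ, hk, ?_⟩, by
    rw [hammingDist_self]; push_cast; positivity⟩
  intro x y hxy
  have h1 : blockRep σ x = blockRep σ y := by
    rw [blockRep_eq_iff]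
    refine ⟨fun j hj => hxy j (by simp [outsideBlocks, hj]), fun i j hj j' hj' => ?_⟩
    obtain ⟨a, ha⟩ := Finset.card_eq_one.1 (hσ i)
    rw [ha, Finset.mem_singleton] at hj hj'
    rw [hj, hj']
  have h2 := hZ x y (Finset.dependsOn_restrict _ hxy)
  simp [maskTo, h1, h2]

lemma outsideBlocks_card {σ : Fin m → Finset (Fin n)} {b : ℕ} (hσ : ∀ i, (σ i).card = b)
    (hdisj : ∀ i i', i ≠ i' → Disjoint (σ i) (σ i')) :
    (outsideBlocks σ).card = n - m * b := by
  rw [outsideBlocks, Finset.card_compl, Fintype.card_fin,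
    Finset.card_biUnion fun i _ i' _ hne => hdisj i i' hne]
  simp [hσ]

end Close

/-! ### The hard pair of random functions -/

/-- There are `m` disjoint parts of `M` coordinates each. -/
lemma exists_parts {n m M : ℕ} (h : m * M ≤ n) : ∃ P : Fin m → Finset (Fin n),
    (∀ i, (P i).card = M) ∧ ∀ i i', i ≠ i' → Disjoint (P i) (P i') := by
  refine ⟨fun i => Finset.univ.filter fun j => (i : ℕ) * M ≤ j ∧ (j : ℕ) < (i + 1) * M, ?_, ?_⟩
  · intro i
    have h1 : (Finset.univ.filter fun j : Fin n => (i : ℕ) * M ≤ j ∧ (j : ℕ) < (i + 1) * M).map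
        Fin.valEmbedding = Finset.Ico ((i : ℕ) * M) ((i + 1) * M) := by
      ext j
      simp only [Finset.mem_map, Finset.mem_filter, Finset.mem_univ, true_and, Finset.mem_Ico,
        Fin.valEmbedding_apply]
      constructor
      · rintro ⟨j, hj, rfl⟩
        exact hj
      · intro hj
        have h2 : ((i : ℕ) + 1) * M ≤ m * M := Nat.mul_le_mul_right _ i.2
        exact ⟨⟨j, by omega⟩, hj, rfl⟩
    rw [← Finset.card_map Fin.valEmbedding, h1, Nat.card_Ico, Nat.add_mul]
    omega
  · intro i i' hne
    refine Finset.disjoint_left.2 fun j hj hj' => hne (Fin.ext ?_)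
    simp only [Finset.mem_filter, Finset.mem_univ, true_and] at hj hj'
    have h1 : (i : ℕ) < i' + 1 := lt_of_mul_lt_mul_right (hj.1.trans_lt hj'.2) (Nat.zero_le M)
    have h2 : (i' : ℕ) < i + 1 := lt_of_mul_lt_mul_right (hj'.1.trans_lt hj.2) (Nat.zero_le M)
    omega

/-- A set of points defined by the coordinates in `T` can have any density in
`0, 2⁻ᵗ, 2 * 2⁻ᵗ, …, 1`, where `t = T.card`. -/
lemma exists_set_of_restrict {n z : ℕ} (T : Finset (Fin n)) (hz : z ≤ 2 ^ T.card) :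
    ∃ Z : Finset (Fin n → Bool), Z.card = z * 2 ^ (n - T.card) ∧
      ∀ x y, T.restrict x = T.restrict y → (x ∈ Z ↔ y ∈ Z) := by
  obtain ⟨Z₀, -, hZ₀⟩ := Finset.exists_subset_card_eq
    (s := (Finset.univ : Finset (T → Bool))) (n := z) (by simpa using hz)
  refine ⟨Finset.univ.filter fun x => T.restrict x ∈ Z₀, ?_, fun x y hxy => by simp [hxy]⟩
  rw [Finset.card_eq_sum_card_fiberwise (f := T.restrict) (t := Z₀)
    (fun x hx => by simpa using hx), ← hZ₀, ← smul_eq_mul, ← Finset.sum_const]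
  refine Finset.sum_congr rfl fun c hc => ?_
  rw [← card_filter_restrict_eq T c]
  congr 1
  ext x
  simp only [Finset.mem_filter, Finset.mem_univ, true_and, and_iff_right_iff_imp]
  rintro rfl
  exact hc

set_option maxHeartbeats 1000000 in
/-- The hard instances with sixteen hidden blocks of size `b`, each in a part of size `w + b`, and
a support `Z` of density `z / 2 ^ t`, where `t = k - 16 * w`. -/
lemma not_isTolerantJuntaTester_of_blocks {k b w z q : ℕ} {ε₁ ε₂ : ℝ} (hb : 1 ≤ b)
    (hw : 16 * w ≤ k) (hz : z ≤ 2 ^ (k - 16 * w)) (hε₁ : 0 ≤ ε₁)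
    (hfar : ε₂ * 2 ^ (k - 16 * w) ≤ z * (1 / 2 - 1 / 2 ^ (8 * b)))
    (hclose : b = 1 ∨
      z * (1 - 5 / 18 * (2 ^ 8 / 2 ^ (8 * b))) ≤ 2 * (ε₁ * 2 ^ (k - 16 * w)))
    (hlarge : (260 : ℝ) ≤ z * 2 ^ (16 * w))
    (hexp : (2 : ℝ) ^ (k + 16 * b) * 2 ^ (2 * (z * 2 ^ (16 * w)) : ℝ) *
      Real.exp (-(2 * (z * 2 ^ (16 * w)))) ≤ 1 / 20)
    (hq : (q : ℝ) * (q - 1) * ((w + b).choose b : ℝ)⁻¹ ≤ 1 / 10) (T : RandomizedAlgorithm)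
    (hT : ∀ t ∈ (T (k + 16 * b)).support, ∀ f, t.numQueries f ≤ q) :
    ¬ IsTolerantJuntaTester k ε₁ ε₂ T := by
  classical
  obtain ⟨n, hn⟩ : ∃ n, n = k + 16 * b := ⟨_, rfl⟩
  rw [← hn] at hT
  rw [← hn] at hexp
  obtain ⟨P, hP, hPdisj⟩ := exists_parts (n := n) (m := 16) (M := w + b) (by omega)
  have hTcard : (outsideBlocks P).card = k - 16 * w := by
    rw [outsideBlocks_card hP hPdisj]
    omega
  obtain ⟨Z, hZcard, hZ⟩ := exists_set_of_restrict (z := z) (outsideBlocks P) (by rwa [hTcard])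
  rw [hTcard, show n - (k - 16 * w) = 16 * w + 16 * b by omega] at hZcard
  have hZr : (Z.card : ℝ) = z * 2 ^ (16 * w) * 2 ^ (16 * b) := by
    rw [hZcard]
    push_cast
    ring
  have hZF : (Z.card : ℝ) / 2 ^ (16 * b) = z * 2 ^ (16 * w) := by
    rw [hZr]
    field_simp
  have h2n : (2 : ℝ) ^ n = 2 ^ (k - 16 * w) * (2 ^ (16 * w) * 2 ^ (16 * b)) := by
    rw [← pow_add, ← pow_add]
    congr 1
    omega
  have hσ : ∀ σ ∈ blockSystems P b, (∀ i, (σ i).card = b) ∧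
      (∀ i i', i ≠ i' → Disjoint (σ i) (σ i')) ∧ (outsideBlocks σ).card = k ∧
      ∀ x y, (outsideBlocks σ).restrict x = (outsideBlocks σ).restrict y → (x ∈ Z ↔ y ∈ Z) := by
    intro σ hσ
    simp only [blockSystems, Fintype.mem_piFinset, Finset.mem_powersetCard] at hσ
    have h1 : ∀ i i', i ≠ i' → Disjoint (σ i) (σ i') := fun i i' hne =>
      Finset.disjoint_of_subset_left (hσ i).1
        (Finset.disjoint_of_subset_right (hσ i').1 (hPdisj i i' hne))
    refine ⟨fun i => (hσ i).2, h1, ?_, fun x y hxy => hZ x y ?_⟩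
    · rw [outsideBlocks_card (fun i => (hσ i).2) h1]
      omega
    · ext ⟨j, hj⟩
      have hj' : j ∈ outsideBlocks σ := by
        simp only [outsideBlocks, Finset.mem_compl, Finset.mem_biUnion, Finset.mem_univ, true_and,
          not_exists] at hj ⊢
        exact fun i hi => hj i ((hσ i).1 hi)
      exact congrFun hxy ⟨j, hj'⟩
  refine not_isTolerantJuntaTester (n := n) (blockSystems P b) ?_ blockRep Z
    (α := ((w + b).choose b : ℝ)⁻¹) (fun x y hxy => card_blockRep_eq_le hP hPdisj (by omega) hxy)
    (by positivity) hq (fun σ hσI => ?_) ?_ T hT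
  · exact Fintype.piFinset_nonempty.2 fun i => Finset.powersetCard_nonempty.2 (by rw [hP i]; omega)
  · obtain ⟨h1, h2, h3, h4⟩ := hσ σ hσI
    by_cases hb1 : b = 1
    · have h5 : ∀ h : BoolFun n, IsCloseToJuntas k ε₁ (maskTo Z (h ∘ blockRep σ)) :=
        isCloseToJuntas_of_card_one hε₁ (fun i => by rw [h1 i, hb1]) h3.le h4
      simp [h5]
    · have h5 := hclose.resolve_left hb1
      have h6 : n - (outsideBlocks σ).card = 16 * b := by omega
      refine card_not_isCloseToJuntas_le (v := 2 ^ (8 * b + 8))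
        (fun i => Finset.card_pos.1 (by rw [h1 i]; omega)) h2 h3.le h4 (by positivity) ?_ ?_ ?_
      · rw [h6]
        ring
      · rw [h6, hZF, hZr, h2n]
        have h7 : (z * 2 ^ (16 * w) * 2 ^ (16 * b) - 5 / 18 * 2 ^ (8 * b + 8) * (z * 2 ^ (16 * w)) : ℝ)
            = (2 ^ (16 * w) * 2 ^ (16 * b)) * (z * (1 - 5 / 18 * (2 ^ 8 / 2 ^ (8 * b)))) := by
          have h8 : (2 : ℝ) ^ (16 * b) = 2 ^ (8 * b) * 2 ^ (8 * b) := by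
            rw [← pow_add]
            congr 1
            omega
          rw [h8, pow_add]
          field_simp
        rw [h7]
        have h9 : (0 : ℝ) ≤ 2 ^ (16 * w) * 2 ^ (16 * b) := by positivity
        nlinarith [mul_le_mul_of_nonneg_left h5 h9]
      · rw [h6, hZF]
        exact hlarge
  · have h1 := card_not_isFarFromJuntas_le (k := k) (ε := ε₂) Z
      (s := Z.card / 2 ^ (8 * b)) (div_nonneg (Nat.cast_nonneg _) (by positivity)) (by
        rw [h2n, hZr]
        have h9 : (0 : ℝ) ≤ 2 ^ (16 * w) * 2 ^ (16 * b) := by positivity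
        have h10 := mul_le_mul_of_nonneg_left hfar h9
        calc _ = 2 ^ (16 * w) * 2 ^ (16 * b) * (ε₂ * 2 ^ (k - 16 * w)) := by ring
          _ ≤ _ := h10
          _ = _ := by ring)
    refine h1.trans (mul_le_mul_of_nonneg_right ?_ (by positivity))
    have h2 : (2 * Z.card / 2 ^ (n - k) : ℝ) = 2 * (z * 2 ^ (16 * w)) := by
      rw [show n - k = 16 * b by omega, ← hZF]
      ring
    have h3 : (2 * (Z.card / 2 ^ (8 * b)) ^ 2 / Z.card : ℝ) = 2 * (z * 2 ^ (16 * w)) := by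
      have h8 : (2 : ℝ) ^ (16 * b) = 2 ^ (8 * b) * 2 ^ (8 * b) := by
        rw [← pow_add]
        congr 1
        omega
      have h9 : (Z.card : ℝ) ≠ 0 := by
        intro h0
        rw [h0, zero_div] at hZF
        linarith
      rw [← hZF, h8]
      field_simp
    rw [h2, h3]
    exact hexp

/-- A single query cannot tell a random constant from a uniformly random function. -/
lemma not_isTolerantJuntaTester_of_numQueries_le_one {k : ℕ} {ε₁ ε₂ : ℝ} (hε₁ : 0 ≤ ε₁)
    (hε₂ : ε₂ ≤ 0.49) (T : RandomizedAlgorithm)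
    (hT : ∀ t ∈ (T (k + 30)).support, ∀ f, t.numQueries f ≤ 1) :
    ¬ IsTolerantJuntaTester k ε₁ ε₂ T := by
  classical
  obtain ⟨n, hn⟩ : ∃ n, n = k + 30 := ⟨_, rfl⟩
  rw [← hn] at hT
  have hcard : ((Finset.univ : Finset (Fin n → Bool)).card : ℝ) = 2 ^ n := by
    simp
  refine not_isTolerantJuntaTester (n := n) (Finset.univ : Finset Unit)
    ⟨(), Finset.mem_univ _⟩ (fun _ _ _ => false) Finset.univ (α := 1) (by simp) (by norm_num)
    (q := 1) (by norm_num) (fun σ _ => ?_) ?_ T hT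
  · have h1 : ∀ h : BoolFun n, IsCloseToJuntas (n := n) k ε₁
        (maskTo Finset.univ (h ∘ fun _ _ => false)) := by
      intro h
      refine ⟨maskTo Finset.univ (h ∘ fun _ _ => false), ⟨∅, by simp, fun x y _ => ?_⟩, ?_⟩
      · simp [maskTo]
      · rw [hammingDist_self]
        push_cast
        positivity
    simp [h1]
  · refine (card_not_isFarFromJuntas_le (k := k) (ε := ε₂) Finset.univ
      (s := 0.01 * 2 ^ n) (by positivity) ?_).trans
      (mul_le_mul_of_nonneg_right ?_ (by positivity))
    · rw [hcard]
      have : (0 : ℝ) < 2 ^ n := by positivity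
      nlinarith
    · rw [hcard, hn]
      have h1 : (2 * 2 ^ (k + 30) / 2 ^ (k + 30 - k) : ℝ) = 2 * 2 ^ k := by
        rw [Nat.add_sub_cancel_left, pow_add]
        field_simp
      have h2 : (2 * (0.01 * 2 ^ (k + 30)) ^ 2 / 2 ^ (k + 30) : ℝ) = 0.0002 * 2 ^ 30 * 2 ^ k := by
        rw [pow_add]
        field_simp
        norm_num
      rw [h1, h2, ← Real.rpow_natCast 2 (k + 30), Real.rpow_def_of_pos two_pos,
        Real.rpow_def_of_pos two_pos, ← Real.exp_add, ← Real.exp_add]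
      have h3 : (k : ℝ) ≤ 2 ^ k := by exact_mod_cast Nat.lt_two_pow_self.le
      have h4 : (1 : ℝ) ≤ 2 ^ k := one_le_pow₀ (by norm_num)
      have h5 := Real.log_two_lt_d9
      have h6 := Real.log_two_gt_d9
      have h7 : (1 / 20 : ℝ) = (20 : ℝ)⁻¹ := by norm_num
      rw [h7]
      have h8 : Real.exp (-19) ≤ (20 : ℝ)⁻¹ := by
        rw [Real.exp_neg]
        exact inv_anti₀ (by norm_num) (by linarith [Real.add_one_le_exp (19 : ℝ)])
      refine le_trans (Real.exp_le_exp.2 ?_) h8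
      push_cast
      nlinarith

/-! ### The choice of parameters -/

/-- `((w + b).choose b)` is at least `((w + 1) / b) ^ b`. -/
lemma pow_le_choose_add {w b : ℕ} {r : ℝ} (hr : 0 ≤ r) (h : r * b ≤ w + 1) :
    r ^ b ≤ ((w + b).choose b : ℝ) := by
  have h1 := Nat.pow_le_choose (α := ℝ) b (w + b)
  refine le_trans ?_ h1
  have h2 : w + b + 1 - b = w + 1 := by omega
  have h3 : ((b.factorial : ℕ) : ℝ) ≤ (b : ℝ) ^ b := by exact_mod_cast Nat.factorial_le_pow b
  rw [h2, le_div_iff₀ (by positivity)]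
  calc r ^ b * b.factorial ≤ r ^ b * (b : ℝ) ^ b := by gcongr
    _ = (r * b) ^ b := (mul_pow _ _ _).symm
    _ ≤ _ := by
      push_cast
      gcongr

lemma linear_le_two_rpow {k : ℝ} (hk : 100 ≤ k) : 2.5 * k + 30 ≤ 2 ^ (k / 2) := by
  have h1 : (1 + 0.17 * k) ≤ 2 ^ (k / 4) := by
    rw [Real.rpow_def_of_pos two_pos]
    have h2 := Real.add_one_le_exp (Real.log 2 * (k / 4))
    nlinarith [Real.log_two_gt_d9]
  have h3 : (2 : ℝ) ^ (k / 2) = 2 ^ (k / 4) * 2 ^ (k / 4) := by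
    rw [← Real.rpow_add two_pos]
    congr 1
    ring
  rw [h3]
  have h4 : (1 + 0.17 * k) * (1 + 0.17 * k) ≤ 2 ^ (k / 4) * (2 : ℝ) ^ (k / 4) := by gcongr
  nlinarith

/-- The union bound succeeds since `log 2 < 0.7 < 1`: the `exp (-2 F)` of Hoeffding's inequality beats
the number `2 ^ (2 F)` of sets of heavy cells. -/
lemma union_bound_le {k b : ℕ} {F : ℝ} (hF : 0.7 * (k + 16 * b) + 3 ≤ 0.6 * F) :
    (2 : ℝ) ^ (k + 16 * b) * 2 ^ (2 * F : ℝ) * Real.exp (-(2 * F)) ≤ 1 / 20 := by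
  have hF0 : 0 ≤ F := by
    have : (0 : ℝ) ≤ k := Nat.cast_nonneg _
    have : (0 : ℝ) ≤ b := Nat.cast_nonneg _
    linarith
  rw [← Real.rpow_natCast 2 (k + 16 * b), Real.rpow_def_of_pos two_pos,
    Real.rpow_def_of_pos two_pos, ← Real.exp_add, ← Real.exp_add]
  have h8 : Real.exp (-3) ≤ 1 / 20 := by
    have h9 : Real.exp 3 = Real.exp 1 ^ 3 := by rw [← Real.exp_nat_mul]; norm_num
    have h10 : (2.718 : ℝ) ^ 3 ≤ Real.exp 1 ^ 3 :=
      pow_le_pow_left₀ (by norm_num) (by linarith [Real.exp_one_gt_d9]) 3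
    rw [Real.exp_neg, h9, one_div]
    refine inv_anti₀ (by norm_num) (le_trans ?_ h10)
    norm_num
  refine le_trans (Real.exp_le_exp.2 ?_) h8
  have h5 := Real.log_two_lt_d9
  have h6 : (0 : ℝ) ≤ (k + 16 * b : ℕ) := Nat.cast_nonneg _
  have h7 : Real.log 2 * (k + 16 * b : ℕ) ≤ 0.7 * (k + 16 * b : ℕ) := by gcongr; linarith
  have h8 : Real.log 2 * (2 * F) ≤ 0.7 * (2 * F) := by gcongr; linarith
  push_cast at h7 ⊢
  linarith

set_option maxHeartbeats 1000000 in
/-- The bound for large `k`: sixteen blocks whose size is an eighth of the logarithm of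
`(1 - ε₁ / ε₂)⁻¹`. -/
lemma not_isTolerantJuntaTester_of_large {C : ℝ} (hC : 0 < C) {k : ℕ} (hk : 100 ≤ k)
    (hkC : 640 * (1 + C) ≤ (k : ℝ) ^ (0.005 : ℝ)) {ε₁ ε₂ : ℝ} (hε₁ : 0 < ε₁) (hε : ε₁ < ε₂)
    (hε₂ : ε₂ ≤ 0.49) (hgap : (2 : ℝ) ^ (-(C * (k : ℝ) ^ (0.99 : ℝ))) ≤ ε₂ - ε₁) {c : ℝ}
    (hc : c ≤ 0.0001) (T : RandomizedAlgorithm)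
    (hT : ∀ n, ∀ t ∈ (T n).support, ∀ f,
      (t.numQueries f : ℝ) < (k : ℝ) ^ (-(c * Real.logb 2 (1 - ε₁ / ε₂)))) :
    ¬ IsTolerantJuntaTester k ε₁ ε₂ T := by
  have hε₂pos : 0 < ε₂ := hε₁.trans hε
  have hkr : (100 : ℝ) ≤ k := by exact_mod_cast hk
  have hk0 : (0 : ℝ) < k := by linarith
  set η : ℝ := 1 - ε₁ / ε₂ with hη
  have hηε : η * ε₂ = ε₂ - ε₁ := by rw [hη]; field_simp
  have hη0 : 0 < η := by
    rw [hη, sub_pos, div_lt_one hε₂pos]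
    exact hε
  have hη1 : η < 1 := by
    rw [hη]
    linarith [div_pos hε₁ hε₂pos]
  obtain ⟨L, hL⟩ : ∃ L, L = -Real.logb 2 η := ⟨_, rfl⟩
  have hηL : η = 2 ^ (-L) := by
    rw [hL, neg_neg, Real.rpow_logb two_pos (by norm_num) hη0]
  have hL0 : 0 < L := by
    rw [hL, neg_pos]
    exact Real.logb_neg (by norm_num) hη0 hη1
  set s : ℝ := C * (k : ℝ) ^ (0.99 : ℝ) with hs
  have hs0 : 0 < s := by positivity
  have hk1 : (k : ℝ) = (k : ℝ) ^ (0.99 : ℝ) * ((k : ℝ) ^ (0.005 : ℝ) * (k : ℝ) ^ (0.005 : ℝ)) := by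
    rw [← Real.rpow_add hk0, ← Real.rpow_add hk0]
    norm_num
  set u : ℝ := (k : ℝ) ^ (0.005 : ℝ) with hu
  set p : ℝ := (k : ℝ) ^ (0.99 : ℝ) with hp
  have hp1 : 1 ≤ p := Real.one_le_rpow (by linarith) (by norm_num)
  have hu1 : 640 ≤ u := by linarith
  have hsk : s ≤ k / 2 := by
    rw [hs]
    have h1 : 2 * C ≤ u * u := by
      have h2 : u ≤ u * u := le_mul_of_one_le_right (by linarith) (by linarith)
      linarith
    have h2 := mul_le_mul_of_nonneg_left h1 (by linarith : 0 ≤ p)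
    rw [← hk1] at h2
    linarith
  have hLs : L ≤ s := by
    have h1 : (2 : ℝ) ^ (-s) ≤ 2 ^ (-L) := by
      rw [← hηL]
      refine hgap.trans ?_
      rw [← hηε]
      exact mul_le_of_le_one_right hη0.le (by linarith)
    have h2 := (Real.rpow_le_rpow_left_iff (by norm_num : (1 : ℝ) < 2)).1 h1
    linarith
  -- the exponent `8 b ≤ L` for `b ≥ 2` makes `2 ^ (-8 b) ≥ η`, and `L ≤ 16 b` holds always
  obtain ⟨b, hb⟩ : ∃ b, b = max 1 ⌊L / 8⌋₊ := ⟨_, rfl⟩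
  have hb1 : 1 ≤ b := by rw [hb]; exact le_max_left _ _
  have hb1r : (1 : ℝ) ≤ b := by exact_mod_cast hb1
  have hbL : L ≤ 16 * b := by
    have h1 := Nat.lt_floor_add_one (L / 8)
    have h2 : ((⌊L / 8⌋₊ : ℕ) : ℝ) ≤ b := by rw [hb]; exact_mod_cast le_max_right _ _
    linarith
  have hbU : (b : ℝ) ≤ 1 + L / 8 := by
    rw [hb]
    push_cast
    refine max_le (by linarith) ?_
    linarith [Nat.floor_le (by positivity : 0 ≤ L / 8)]
  have hb2 : b = 1 ∨ (2 ≤ b ∧ 8 * (b : ℝ) ≤ L) := by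
    rcases le_or_gt ⌊L / 8⌋₊ 1 with h | h
    · left
      rw [hb, max_eq_left h]
    · right
      rw [max_eq_right h.le] at hb
      refine ⟨by omega, ?_⟩
      have := Nat.floor_le (by positivity : 0 ≤ L / 8)
      rw [← hb] at this
      linarith
  -- `t ≥ t₀` coordinates define `Z`, so its density is adjustable to within `η ε₂ / 256`
  obtain ⟨t₀, ht₀⟩ : ∃ t₀, t₀ = ⌈s⌉₊ + 8 := ⟨_, rfl⟩
  have ht₀U : (t₀ : ℝ) < s + 9 := by
    rw [ht₀]
    push_cast
    linarith [Nat.ceil_lt_add_one hs0.le]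
  have ht₀L : s + 8 ≤ t₀ := by
    rw [ht₀]
    push_cast
    linarith [Nat.le_ceil s]
  have ht₀k : t₀ ≤ k := by
    have : (t₀ : ℝ) ≤ k := by linarith
    exact_mod_cast this
  obtain ⟨w, hw⟩ : ∃ w, w = (k - t₀) / 16 := ⟨_, rfl⟩
  have hwk : 16 * w ≤ k := by omega
  obtain ⟨t, ht⟩ : ∃ t, t = k - 16 * w := ⟨_, rfl⟩
  have htt : t₀ ≤ t := by omega
  have hwL : (k : ℝ) - t₀ ≤ 16 * (w + 1) := by
    have h1 : k ≤ t₀ + 16 * (w + 1) := by omega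
    have h2 : (k : ℝ) ≤ t₀ + 16 * (w + 1) := by exact_mod_cast h1
    linarith
  have hw1 : (k : ℝ) / 64 ≤ w + 1 := by linarith
  have h2t : (2 : ℝ) ^ (s + 8) ≤ 2 ^ t := by
    rw [← Real.rpow_natCast]
    refine Real.rpow_le_rpow_of_exponent_le (by norm_num) (ht₀L.trans ?_)
    exact_mod_cast htt
  have hgap' : 256 ≤ η * (ε₂ * 2 ^ t) := by
    have h1 : (2 : ℝ) ^ (-s) * 2 ^ (s + 8) = 256 := by
      rw [← Real.rpow_add two_pos, neg_add_cancel_left]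
      norm_num
    calc (256 : ℝ) = 2 ^ (-s) * 2 ^ (s + 8) := h1.symm
      _ ≤ (ε₂ - ε₁) * 2 ^ t := by gcongr
      _ = _ := by rw [← hηε]; ring
  have h256 : (256 : ℝ) ≤ 2 ^ t := by
    refine le_trans ?_ h2t
    have : (2 : ℝ) ^ (8 : ℝ) ≤ 2 ^ (s + 8) :=
      Real.rpow_le_rpow_of_exponent_le (by norm_num) (by linarith)
    norm_num at this
    exact this
  -- `β` is the relative loss in the distance to juntas; `z` is least with `z (1 - β) ≥ 2 ε₂ 2 ^ t`
  obtain ⟨β, hβ⟩ : ∃ β : ℝ, β = 2 / 2 ^ (8 * b) := ⟨_, rfl⟩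
  have hβ0 : 0 < β := by rw [hβ]; positivity
  have hβ1 : β ≤ 1 / 128 := by
    have h1 : (2 : ℝ) ^ 8 ≤ 2 ^ (8 * b) := pow_le_pow_right₀ (by norm_num) (by omega)
    rw [hβ, div_le_div_iff₀ (by positivity) (by norm_num)]
    linarith
  obtain ⟨E, hE⟩ : ∃ E : ℝ, E = ε₂ * 2 ^ t := ⟨_, rfl⟩
  have hE0 : 0 < E := by rw [hE]; positivity
  rw [← hE] at hgap'
  obtain ⟨z, hz⟩ : ∃ z, z = ⌈2 * E / (1 - β)⌉₊ := ⟨_, rfl⟩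
  have hβ' : 0 < 1 - β := by linarith
  have hzL : 2 * E ≤ z * (1 - β) := by
    rw [← div_le_iff₀ hβ', hz]
    exact Nat.le_ceil _
  have hzU : (z : ℝ) ≤ 2 * E / (1 - β) + 1 := by
    rw [hz]
    exact (Nat.ceil_lt_add_one (by positivity)).le
  have hzE : 2 * E ≤ z := by
    have : 0 ≤ z * β := mul_nonneg (Nat.cast_nonneg _) hβ0.le
    linarith
  have hdiv : 2 * E / (1 - β) ≤ 2 * E * (1 + 2 * β) := by
    rw [div_le_iff₀ hβ']
    linarith [mul_nonneg (mul_nonneg hE0.le hβ0.le) (by linarith : 0 ≤ 1 - 2 * β)]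
  have hz2 : z ≤ 2 ^ t := by
    have h1 : (z : ℝ) ≤ 2 ^ t := by
      have h2 : E ≤ 0.49 * 2 ^ t := by rw [hE]; gcongr
      have h3 : 2 * E * (1 + 2 * β) ≤ 2 * E * (1 + 1 / 64) := by gcongr; linarith
      linarith
    exact_mod_cast h1
  -- `F` is the number of cells contained in `Z`: about `2 ε₂ 2 ^ k`, far more than linear in `k`
  obtain ⟨F, hF⟩ : ∃ F : ℝ, F = z * 2 ^ (16 * w) := ⟨_, rfl⟩
  have hFL : 5 * k + 60 ≤ F := by
    have h1 : (2 : ℝ) ^ t * 2 ^ (16 * w) = 2 ^ (k : ℝ) := by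
      rw [← pow_add, Real.rpow_natCast]
      congr 1
      omega
    have h2 : (2 : ℝ) ^ (-s) ≤ ε₂ := by linarith
    have h3 : (2 : ℝ) ^ ((k : ℝ) / 2) ≤ ε₂ * 2 ^ (k : ℝ) := by
      calc (2 : ℝ) ^ ((k : ℝ) / 2) ≤ 2 ^ (-s + k) :=
            Real.rpow_le_rpow_of_exponent_le (by norm_num) (by linarith)
        _ = 2 ^ (-s) * 2 ^ (k : ℝ) := Real.rpow_add two_pos _ _
        _ ≤ _ := by gcongr
    have h4 := linear_le_two_rpow hkr
    have h5 : 2 * E * 2 ^ (16 * w) ≤ F := by rw [hF]; gcongr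
    have h6 : 2 * E * 2 ^ (16 * w) = 2 * (ε₂ * 2 ^ (k : ℝ)) := by
      rw [hE, ← h1]
      ring
    linarith
  -- `c * L ≤ 0.0016 * b`, so the square of the number of queries is below `k ^ (0.005 b)`
  obtain ⟨q, hq⟩ : ∃ q, q = ⌊(k : ℝ) ^ (c * L)⌋₊ := ⟨_, rfl⟩
  have hexp : -(c * Real.logb 2 η) = c * L := by rw [hL]; ring
  rw [hexp] at hT
  have hqu : (q : ℝ) * (q - 1) ≤ u ^ b := by
    have h1 : (q : ℝ) ≤ (k : ℝ) ^ (c * L) := by rw [hq]; exact Nat.floor_le (by positivity)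
    have h2 : (k : ℝ) ^ (c * L) * (k : ℝ) ^ (c * L) ≤ u ^ b := by
      rw [← Real.rpow_add hk0, hu, ← Real.rpow_natCast, ← Real.rpow_mul hk0.le]
      refine Real.rpow_le_rpow_of_exponent_le (by linarith) ?_
      have h3 : c * L ≤ 0.0001 * (16 * b) := by
        calc c * L ≤ 0.0001 * L := by gcongr
          _ ≤ _ := by gcongr
      linarith
    have h4 : (0 : ℝ) ≤ q := Nat.cast_nonneg _
    linarith [mul_le_mul h1 h1 h4 (h4.trans h1)]
  have hchoose : (10 * u) ^ b ≤ ((w + b).choose b : ℝ) := by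
    refine pow_le_choose_add (by positivity) ?_
    have h1 : (b : ℝ) ≤ (1 + C) * p := by
      have h2 : L ≤ C * p := hLs
      have h3 : 0 ≤ C * p := by positivity
      linarith
    have h2 : 10 * u * b ≤ k / 64 := by
      calc 10 * u * b ≤ 10 * u * ((1 + C) * p) := by gcongr
        _ = 10 * (1 + C) * (u * p) := by ring
        _ ≤ (u / 64) * (u * p) := by gcongr; linarith
        _ = k / 64 := by rw [hk1]; ring
    linarith
  refine not_isTolerantJuntaTester_of_blocks (b := b) (w := w) (z := z) (q := q) hb1 hwk
    (by rwa [← ht]) hε₁.le ?_ ?_ ?_ ?_ ?_ T fun t' ht' f => ?_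
  · rw [← ht, ← hE]
    have : (1 : ℝ) / 2 - 1 / 2 ^ (8 * b) = (1 - β) / 2 := by rw [hβ]; ring
    rw [this]
    linarith
  · refine hb2.imp id fun ⟨hb2, hbL'⟩ => ?_
    have h1 : (5 / 18 * (2 ^ 8 / 2 ^ (8 * b)) : ℝ) = 5 / 18 * 128 * β := by rw [hβ]; ring
    have h2 : 2 * η ≤ β := by
      rw [hηL, hβ, ← Real.rpow_natCast, div_eq_mul_inv, ← Real.rpow_neg two_pos.le]
      gcongr
      · norm_num
      · push_cast
        exact hbL'
    have h3 : ε₁ * 2 ^ t = E * (1 - η) := by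
      rw [hE]
      have : ε₁ = ε₂ * (1 - η) := by linarith
      rw [this]
      ring
    have h4 : β ≤ 1 / 2 ^ 15 := by
      have h5 : (2 : ℝ) ^ 16 ≤ 2 ^ (8 * b) := pow_le_pow_right₀ (by norm_num) (by omega)
      rw [hβ, div_le_div_iff₀ (by positivity) (by positivity)]
      linarith
    rw [← ht, h1, h3]
    have h5 : (z : ℝ) ≤ 2 * E * (1 + 2 * β + η / 512) := by linarith
    have h6 : 0 ≤ 1 - 5 / 18 * 128 * β := by
      norm_num at h4
      linarith
    have h7 : (1 + 2 * β + η / 512) * (1 - 5 / 18 * 128 * β) ≤ 1 - η := by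
      linarith [mul_pos hβ0 hβ0, mul_pos hβ0 hη0]
    calc (z : ℝ) * (1 - 5 / 18 * 128 * β) ≤
        2 * E * (1 + 2 * β + η / 512) * (1 - 5 / 18 * 128 * β) := by gcongr
      _ = 2 * E * ((1 + 2 * β + η / 512) * (1 - 5 / 18 * 128 * β)) := by ring
      _ ≤ 2 * E * (1 - η) := by gcongr
      _ = _ := by ring
  · rw [← hF]
    linarith
  · rw [← hF]
    refine union_bound_le ?_
    have : 16 * (b : ℝ) ≤ 16 + k := by linarith
    linarith
  · have h1 : (0 : ℝ) < (w + b).choose b := lt_of_lt_of_le (by positivity) hchoose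
    rw [← div_eq_mul_inv, div_le_div_iff₀ h1 (by norm_num)]
    have h2 : 10 * u ^ b ≤ (10 * u) ^ b := by
      rw [mul_pow]
      gcongr
      exact le_self_pow₀ (by norm_num) (by omega)
    linarith
  · rw [hq]
    exact Nat.le_floor (hT _ t' ht' f).le

/-- For bounded `k` the claimed number of queries is at most two once `c` is small enough. -/
lemma rpow_le_two_of_small {C : ℝ} (hC : 0 < C) {k K : ℕ} (hK : 1 ≤ K) (hkK : k ≤ K)
    {ε₁ ε₂ : ℝ} (hε₁ : 0 < ε₁) (hε : ε₁ < ε₂) (hε₂ : ε₂ ≤ 0.49)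
    (hgap : (2 : ℝ) ^ (-(C * (k : ℝ) ^ (0.99 : ℝ))) ≤ ε₂ - ε₁) {c : ℝ} (hc0 : 0 < c)
    (hc : c * (C * K ^ 2) ≤ 1) :
    (k : ℝ) ^ (-(c * Real.logb 2 (1 - ε₁ / ε₂))) ≤ 2 := by
  have hε₂pos : 0 < ε₂ := hε₁.trans hε
  set η : ℝ := 1 - ε₁ / ε₂ with hη
  have hηε : η * ε₂ = ε₂ - ε₁ := by rw [hη]; field_simp
  have hη0 : 0 < η := by
    rw [hη, sub_pos, div_lt_one hε₂pos]
    exact hε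
  have hη1 : η < 1 := by
    rw [hη]
    linarith [div_pos hε₁ hε₂pos]
  have hK1 : (1 : ℝ) ≤ K := by exact_mod_cast hK
  have hkK' : (k : ℝ) ≤ K := by exact_mod_cast hkK
  have hL0 : 0 < -Real.logb 2 η := neg_pos.2 (Real.logb_neg (by norm_num) hη0 hη1)
  have hL : -Real.logb 2 η ≤ C * K := by
    have h1 : (k : ℝ) ^ (0.99 : ℝ) ≤ K := by
      calc (k : ℝ) ^ (0.99 : ℝ) ≤ (K : ℝ) ^ (0.99 : ℝ) := by gcongr
        _ ≤ (K : ℝ) ^ (1 : ℝ) := Real.rpow_le_rpow_of_exponent_le hK1 (by norm_num)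
        _ = K := Real.rpow_one _
    have h2 : (2 : ℝ) ^ (-(C * K)) ≤ η := by
      calc (2 : ℝ) ^ (-(C * K)) ≤ 2 ^ (-(C * (k : ℝ) ^ (0.99 : ℝ))) :=
            Real.rpow_le_rpow_of_exponent_le (by norm_num) (by
              have := mul_le_mul_of_nonneg_left h1 hC.le
              linarith)
        _ ≤ η := by
          refine hgap.trans ?_
          rw [← hηε]
          exact mul_le_of_le_one_right hη0.le (by linarith)
    have h3 := (Real.le_logb_iff_rpow_le (by norm_num) hη0).2 h2
    linarith
  have h2k : (k : ℝ) ≤ 2 ^ (k : ℝ) := by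
    rw [Real.rpow_natCast]
    exact_mod_cast Nat.lt_two_pow_self.le
  have hexp : -(c * Real.logb 2 η) = c * -Real.logb 2 η := by ring
  rw [hexp]
  calc (k : ℝ) ^ (c * -Real.logb 2 η) ≤ ((2 : ℝ) ^ (k : ℝ)) ^ (c * -Real.logb 2 η) := by
        gcongr
    _ = 2 ^ (k * (c * -Real.logb 2 η)) := (Real.rpow_mul two_pos.le _ _).symm
    _ ≤ 2 ^ (1 : ℝ) := by
      refine Real.rpow_le_rpow_of_exponent_le (by norm_num) ?_
      calc k * (c * -Real.logb 2 η) ≤ K * (c * (C * K)) := by gcongr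
        _ = c * (C * K ^ 2) := by ring
        _ ≤ 1 := hc
    _ = 2 := Real.rpow_one _

theorem theorem2p1 (C A : ℝ) (hC : 0 < C) (hA : 0 < A) :
    ∃ c : ℝ, 0 < c ∧
      ∀ (k : ℕ) (ε₁ ε₂ : ℝ), 0 < ε₁ → ε₁ < ε₂ → ε₂ ≤ 0.49 →
        (2 : ℝ) ^ (-(C * (k : ℝ) ^ (0.99 : ℝ))) ≤ ε₂ - ε₁ →
        (Real.logb 2 (1 / ε₂)) ^ A ≤ (1 - ε₁ / ε₂)⁻¹ →
        ∀ T : RandomizedAlgorithm, IsTolerantJuntaTester k ε₁ ε₂ T →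
          T.MakesAtLeast ((k : ℝ) ^ (-(c * Real.logb 2 (1 - ε₁ / ε₂)))) := by
  obtain ⟨K, hK⟩ : ∃ K : ℕ, ∀ k ≥ K, 100 ≤ k ∧ 640 * (1 + C) ≤ (k : ℝ) ^ (0.005 : ℝ) := by
    have h1 := (tendsto_rpow_atTop (y := 0.005) (by norm_num)).comp
      (tendsto_natCast_atTop_atTop (R := ℝ))
    exact Filter.eventually_atTop.1 ((Filter.eventually_ge_atTop 100).and
      (h1.eventually_ge_atTop (640 * (1 + C))))
  have hK1 : 1 ≤ K := by
    have := (hK K le_rfl).1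
    omega
  have hCK : 0 < C * (K : ℝ) ^ 2 := by
    have : (0 : ℝ) < K := by exact_mod_cast hK1
    positivity
  refine ⟨min 0.0001 (C * K ^ 2)⁻¹, by positivity, fun k ε₁ ε₂ hε₁ hε hε₂ hgap _ T hT => ?_⟩
  by_contra hcon
  simp only [RandomizedAlgorithm.MakesAtLeast, not_exists, not_and, not_le] at hcon
  rcases le_or_gt K k with hk | hk
  · obtain ⟨hk100, hkC⟩ := hK k hk
    exact not_isTolerantJuntaTester_of_large hC hk100 hkC hε₁ hε hε₂ hgap (min_le_left _ _) T
      (fun n t ht f => hcon n f t ht) hT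
  · have h2 := rpow_le_two_of_small hC hK1 hk.le hε₁ hε hε₂ hgap
      (c := min 0.0001 (C * K ^ 2)⁻¹) (by positivity) (by
        calc _ ≤ (C * (K : ℝ) ^ 2)⁻¹ * (C * K ^ 2) :=
              mul_le_mul_of_nonneg_right (min_le_right _ _) hCK.le
          _ = 1 := inv_mul_cancel₀ hCK.ne')
    refine not_isTolerantJuntaTester_of_numQueries_le_one hε₁.le hε₂ T (fun t ht f => ?_) hT
    have h3 : (t.numQueries f : ℝ) < 2 := (hcon _ f t ht).trans_le h2
    have h4 : t.numQueries f < 2 := by exact_mod_cast h3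
    omega
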